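/- Let $\mathbb I=[0,1]$, let $m,n\ge 1$ be integers, $\lambda\ge 0$ and $\beta>1$. Let $S^m(\mathbb I)$ be the set of functions $f$ on $\mathbb I$ such that $f^{(j)}$ is absolutely continuous for $0\le j\le m-1$ and $f^{(m)}\in L^2(\mathbb I)$, with the $\sigma$-algebra generated by the point evaluations. Let $A:\mathbb R\to\mathbb R$ be three times continuously differentiable with $\ddot A>0$, let $f_0\in S^m(\mathbb I)$, and let $\pi$ be a probability density on $\mathbb I$ bounded above and bounded away from $0$. Put $$V(g,\tilde g)=\int_0^1\ddot A(f_0(x))\,g(x)\tilde g(x)\,\pi(x)\,dx,\qquad U(g,\tilde g)=\int_0^1 g^{(m)}(x)\tilde g^{(m)}(x)\,dx ,$$ $$J(f,g)=V(f^\dagger,g^\dagger)+U(f,g),\qquad J(f)=J(f,f),$$ where $f^\dagger$ is the $V$-orthogonal projection of $f$ onto $\mathcal N_m=\{g\in S^m(\mathbb I):U(g,g)=0\}$. Let $(\varphi_\nu,\rho_\nu)_{\nu\ge 1}$ be the complete list, in nondecreasing order of $\rho_\nu$ and with multiplicity, of the eigenpairs of $$(-1)^m\varphi^{(2m)}=\rho\,\ddot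 A(f_0)\,\pi\,\varphi\ \text{ a.e. on }\mathbb I,\qquad \varphi^{(j)}(0)=\varphi^{(j)}(1)=0\quad (m\le j\le 2m-1),$$ with $\varphi\in S^{2m}(\mathbb I)$, normalized by $V(\varphi_\mu,\varphi_\nu)=\delta_{\mu\nu}$. Let $\sigma_1,\dots,\sigma_m>0$. On a probability space $(\Omega,\mathsf P)$, let $(w_\nu)$ be a sequence of independent random variables and $(v_\nu)$ a sequence of independent random variables with $$w_\nu\sim N\Bigl(0,\tfrac{\sigma_\nu^2}{1+n\lambda\sigma_\nu^2}\Bigr),\quad v_\nu\sim N(0,\sigma_\nu^2)\qquad(\nu\le m),$$ $$w_\nu\sim N\Bigl(0,\tfrac1{\rho_\nu^{1+\beta/(2m)}+n\lambda\rho_\nu}\Bigr),\quad v_\nu\sim N\bigl(0,\rho_\nu^{-(1+\beta/(2m))}\bigr)\qquad(\nu>m),$$ and set $G_\lambda=\sum_\nu w_\nu\varphi_\nu$ and $G=\sum_\nu v_\nu\varphi_\nu$. Then almost surely both series converge (absolutely) at every point of $\mathbb I$ and their sums belong to $S^m(\mathbb I)$, so that $\Pi_\lambda(B)=\mathsf P(G_\lambda\in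 B)$ and $\Pi(B)=\mathsf P(G\in B)$ define probability measures on $S^m(\mathbb I)$. The tuning prior $\Pi_\lambda$ is absolutely continuous with respect to the base prior $\Pi$, the infinite product below converges, and for $\Pi$-almost every $f\in S^m(\mathbb I)$ $$\frac{d\Pi_\lambda}{d\Pi}(f)=\prod_{\nu=1}^m(1+n\lambda\sigma_\nu^2)^{1/2}\prod_{\nu=m+1}^\infty\bigl(1+n\lambda\rho_\nu^{-\beta/(2m)}\bigr)^{1/2}\exp\Bigl(-\frac{n\lambda}{2}J(f)\Bigr).$$ Consequently, for all data $(Y_i,X_i)\in\mathbb R\times\mathbb I$, $1\le i\le n$, with $$\ell_{n,\lambda}(f)=\frac1n\sum_{i=1}^n[Y_if(X_i)-A(f(X_i))]-\frac\lambda2J(f),$$ the normalizing constant $\int_{S^m(\mathbb I)}\exp\bigl(\sum_{i=1}^n[Y_if(X_i)-A(f(X_i))]\bigr)d\Pi_\lambda(f)$ is positive and finite, and the posterior distribution under the prior $\Pi_\lambda$ satisfies, for every $\Pi$-measurable $B\subseteq S^m(\mathbb I)$, $$\frac{\int_B\exp\bigl(\sum_{i=1}^n[Y_if(X_i)-A(f(X_i))]\bigr)d\Pi_\lambda(f)}{\int_{S^m(\mathbb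 I)}\exp\bigl(\sum_{i=1}^n[Y_if(X_i)-A(f(X_i))]\bigr)d\Pi_\lambda(f)}=\frac{\int_B\exp(n\ell_{n,\lambda}(f))\,d\Pi(f)}{\int_{S^m(\mathbb I)}\exp(n\ell_{n,\lambda}(f))\,d\Pi(f)} .$$ -/

import Mathlib

open MeasureTheory ProbabilityTheory
open scoped ENNReal NNReal

namespace TuningPrior

noncomputable section

/-- The `j`-th derivative of a function on `[0,1]` (one-sided at the end points). The value of the
extension `Set.IccExtend` outside `[0,1]` plays no role. -/
def deriv01 (j : ℕ) (f : unitInterval → ℝ) : ℝ → ℝ :=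
  iteratedDerivWithin j (Set.IccExtend zero_le_one f) (Set.Icc (0 : ℝ) 1)

/-- The Sobolev space `S^m([0,1])`: the derivatives of order `0, …, m - 1` are absolutely
continuous on `[0,1]` and the `m`-th one is in `L²`. (For `m ≥ 1`, `f` itself is then continuous,
hence in `L²`.) As a type, it carries the σ-algebra generated by the point evaluations. -/
def sobolev (m : ℕ) : Set (unitInterval → ℝ) :=
  {f | (∀ j < m, AbsolutelyContinuousOnInterval (deriv01 j f) 0 1) ∧
    MemLp (deriv01 m f) 2 (volume.restrict (Set.Icc (0 : ℝ) 1))}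

theorem deriv01_zero (j : ℕ) : deriv01 j 0 = 0 := by
  have h : Set.IccExtend (zero_le_one (α := ℝ)) (0 : unitInterval → ℝ) = fun _ => 0 := rfl
  funext x
  unfold deriv01
  rw [h]
  simp

theorem zero_mem_sobolev (m : ℕ) : (0 : unitInterval → ℝ) ∈ sobolev m := by
  refine ⟨fun j _ => ?_, ?_⟩
  · rw [deriv01_zero]
    exact (contDiffOn_const (c := (0 : ℝ))).absolutelyContinuousOnInterval
  · rw [deriv01_zero]
    exact MemLp.zero

/-- `V(g, h) = E[A''(f₀(X)) g(X) h(X)]`, where `X` has density `p` on `[0,1]`. -/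
def formV (A : ℝ → ℝ) (f₀ p g h : unitInterval → ℝ) : ℝ :=
  ∫ x : unitInterval, iteratedDeriv 2 A (f₀ x) * g x * h x * p x

/-- `U(g, h) = ∫₀¹ g^(m) h^(m)`. -/
def formU (m : ℕ) (g h : unitInterval → ℝ) : ℝ :=
  ∫ x in (0 : ℝ)..1, deriv01 m g x * deriv01 m h x

/-- The null space `{g ∈ S^m : U(g, g) = 0}`. -/
def nullSpace (m : ℕ) : Set (unitInterval → ℝ) :=
  {g | g ∈ sobolev m ∧ formU m g g = 0}

open Classical in
/-- The projection `f†` of `f` onto the null space, orthogonal with respect to `V`. -/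
def proj (m : ℕ) (A : ℝ → ℝ) (f₀ p f : unitInterval → ℝ) : unitInterval → ℝ :=
  if h : ∃ q ∈ nullSpace m, ∀ r ∈ nullSpace m, formV A f₀ p (f - q) r = 0 then h.choose else 0

/-- `J(f, g) = V(f†, g†) + U(f, g)`. -/
def formJ (m : ℕ) (A : ℝ → ℝ) (f₀ p f g : unitInterval → ℝ) : ℝ :=
  formV A f₀ p (proj m A f₀ p f) (proj m A f₀ p g) + formU m f g

/-- `(ψ, r)` solves `(-1)^m ψ^(2m) = r A''(f₀) p ψ` almost everywhere on `[0,1]`, with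
`ψ^(j)(0) = ψ^(j)(1) = 0` for `j = m, …, 2m - 1`. -/
def SolvesODE (m : ℕ) (A : ℝ → ℝ) (f₀ p ψ : unitInterval → ℝ) (r : ℝ) : Prop :=
  ψ ∈ sobolev (2 * m) ∧
  (∀ᵐ x : unitInterval,
    (-1) ^ m * deriv01 (2 * m) ψ x = r * iteratedDeriv 2 A (f₀ x) * p x * ψ x) ∧
  ∀ j, m ≤ j → j < 2 * m → deriv01 j ψ 0 = 0 ∧ deriv01 j ψ 1 = 0

/-- `(φ_ν, ρ_ν)` is the list of all eigenpairs of the boundary value problem, with multiplicity,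
in nondecreasing order of the eigenvalues, and normalized with respect to `V`. The index starts
at `0`. -/
structure IsEigensystem (m : ℕ) (A : ℝ → ℝ) (f₀ p : unitInterval → ℝ)
    (φ : ℕ → unitInterval → ℝ) (ρ : ℕ → ℝ) : Prop where
  solves : ∀ ν, SolvesODE m A f₀ p (φ ν) (ρ ν)
  mono : Monotone ρ
  orthonormal : ∀ μ ν, formV A f₀ p (φ μ) (φ ν) = if μ = ν then 1 else 0
  exhaustive : ∀ (ψ : unitInterval → ℝ) (r : ℝ), SolvesODE m A f₀ p ψ r →
    ψ ∈ Submodule.span ℝ {g | ∃ ν, ρ ν = r ∧ φ ν = g}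

/-- `τ_ν²`, the inverse prior variance of the `ν`-th coefficient of the base process `G`. -/
def tauSq (m : ℕ) (β : ℝ) (σ ρ : ℕ → ℝ) (ν : ℕ) : ℝ :=
  if ν < m then (σ ν ^ 2)⁻¹ else ρ ν ^ (1 + β / (2 * m))

/-- The prior variance of the `ν`-th coefficient of `G_λ`. -/
def tunedVar (m n : ℕ) (β lam : ℝ) (σ ρ : ℕ → ℝ) (ν : ℕ) : ℝ :=
  if ν < m then σ ν ^ 2 / (1 + n * lam * σ ν ^ 2)
  else 1 / (ρ ν ^ (1 + β / (2 * m)) + n * lam * ρ ν)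

/-- The random function `t ↦ ∑_ν ξ_ν φ_ν(t)` on `[0,1]`. -/
def randomSeries {Ω : Type*} (φ : ℕ → unitInterval → ℝ) (ξ : ℕ → Ω → ℝ) (ω : Ω) :
    unitInterval → ℝ :=
  fun t => ∑' ν, ξ ν ω * φ ν t

open Classical in
/-- A function in `S^m` as an element of `S^m`; all other functions are sent to `0`. -/
def toSobolev (m : ℕ) (f : unitInterval → ℝ) : sobolev m :=
  if h : f ∈ sobolev m then ⟨f, h⟩ else ⟨0, zero_mem_sobolev m⟩

/-- The law on `S^m` of a random function with paths almost surely in `S^m`. -/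
def sobolevLaw {Ω : Type*} [MeasurableSpace Ω] (P : Measure Ω) (m : ℕ)
    (X : Ω → unitInterval → ℝ) : Measure (sobolev m) :=
  P.map fun ω => toSobolev m (X ω)

/-- `∑_i [y_i f(x_i) - A(f(x_i))]`. -/
def logLik {n : ℕ} (A : ℝ → ℝ) (x : Fin n → unitInterval) (y : Fin n → ℝ)
    (f : unitInterval → ℝ) : ℝ :=
  ∑ i, (y i * f (x i) - A (f (x i)))

/-- The penalized likelihood `ℓ_{n,λ}(f) = n⁻¹ ∑_i [y_i f(x_i) - A(f(x_i))] - (λ/2) J(f, f)`. -/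
def penLik {n : ℕ} (m : ℕ) (A : ℝ → ℝ) (f₀ p : unitInterval → ℝ) (lam : ℝ)
    (x : Fin n → unitInterval) (y : Fin n → ℝ) (f : unitInterval → ℝ) : ℝ :=
  1 / (n : ℝ) * logLik A x y f - lam / 2 * formJ m A f₀ p f f

/-- `∫_B exp(L(f)) dμ(f)`. -/
def expMass {m : ℕ} (μ : Measure (sobolev m)) (L : (unitInterval → ℝ) → ℝ)
    (B : Set (sobolev m)) : ℝ≥0∞ :=
  ∫⁻ f in B, ENNReal.ofReal (Real.exp (L f)) ∂μ

/-- The posterior probability of `B` under the prior `μ`, given the data `(y_i, x_i)`. -/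
def posterior {m n : ℕ} (A : ℝ → ℝ) (x : Fin n → unitInterval) (y : Fin n → ℝ)
    (μ : Measure (sobolev m)) (B : Set (sobolev m)) : ℝ≥0∞ :=
  expMass μ (logLik A x y) B / expMass μ (logLik A x y) Set.univ

end

end TuningPrior

namespace TuningPrior

open Set Filter Topology intervalIntegral

/-! In the coordinates c_ν = V(f, φ_ν) everything is diagonal. The eigenvalue equation, integrated
by parts, gives U(φ_μ, φ_ν) = ρ_ν δ_μν, and the null space of U is spanned by the first m
eigenfunctions, so J(f) = ∑ γ_ν c_ν² with γ_ν = 1 for ν < m and γ_ν = ρ_ν afterwards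
(`hasSum_formJ`). Both priors are product Gaussian laws in these coordinates, and tuning adds nλγ_ν
to the inverse variance τ_ν² of the ν-th one (`tunedVar_eq`). Each coordinate thus contributes the
density √(1 + nλγ_ν/τ_ν²) exp(-nλγ_ν c_ν²/2), and multiplying these gives the formula.

The infinite product is legitimate because ∑ γ_ν/τ_ν² converges. Beyond ν = m the terms are
ρ_ν^(-β/(2m)), and `pow_le_mul_rho` shows that ρ_ν grows at least like ν^(2m); this is where β > 1
enters. The normalizing factors are at least 1 and the exponentials at most 1, so the partial
products are bounded by the limiting constant and dominated convergence on cylinder sets suffices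
(`infinitePi_eq_withDensity`).

To return to functions, a sequence with ∑ (1 + ρ_ν) c_ν² finite is shown to define a pointwise
convergent series in S^m (`eigenSeries_spec`) whose coefficients are recovered by V
(`formV_eigenSeries`). The density is then a function of f, and the law on sequences can be pushed
forward. No completeness of the eigenfunctions in S^m is needed: Π-almost every f is a series by
construction.

For the posterior, the factor exp(-nλJ/2) merges with the likelihood into exp(nℓ), and the positive
finite constant cancels. Finiteness of the normalizing constant follows from convexity of A, which
bounds the log-likelihood by an affine functional of f, and Gaussian exponential moments. -/

/-! ### Sobolev functions as towers of indefinite integrals -/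

/-- A sequence `g 0, …, g m` of functions on `[0,1]`, each the derivative of the previous one in
the sense of indefinite integrals, with `g m` in `L²`. -/
def IsTower (m : ℕ) (g : ℕ → ℝ → ℝ) : Prop :=
  (∀ j < m, ∀ x ∈ Icc (0 : ℝ) 1, g j x = g j 0 + ∫ t in (0 : ℝ)..x, g (j + 1) t) ∧
    MemLp (g m) 2 (volume.restrict (Icc (0 : ℝ) 1))

theorem intervalIntegrable_of_memLp_two {h : ℝ → ℝ}
    (hh : MemLp h 2 (volume.restrict (Icc (0 : ℝ) 1))) : IntervalIntegrable h volume 0 1 := by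
  rw [intervalIntegrable_iff_integrableOn_Icc_of_le zero_le_one]
  exact hh.integrable (by norm_num)

theorem memLp_two_of_continuousOn {h : ℝ → ℝ} (hh : ContinuousOn h (Icc (0 : ℝ) 1)) :
    MemLp h 2 (volume.restrict (Icc (0 : ℝ) 1)) := by
  obtain ⟨C, hC⟩ := isCompact_Icc.exists_bound_of_continuousOn hh
  refine MemLp.of_bound (hh.aestronglyMeasurable measurableSet_Icc) C ?_
  exact (ae_restrict_iff' measurableSet_Icc).2 (Eventually.of_forall hC)

theorem absolutelyContinuousOnInterval_congr {f g : ℝ → ℝ} {a b : ℝ}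
    (hf : AbsolutelyContinuousOnInterval f a b) (h : ∀ x ∈ uIcc a b, f x = g x) :
    AbsolutelyContinuousOnInterval g a b := by
  rw [absolutelyContinuousOnInterval_iff] at hf ⊢
  intro ε hε
  obtain ⟨δ, hδ, H⟩ := hf ε hε
  refine ⟨δ, hδ, fun E hE hlt => ?_⟩
  have := H E hE hlt
  convert! this using 1
  refine Finset.sum_congr rfl fun i hi => ?_
  rw [h _ (hE.1 i hi).1, h _ (hE.1 i hi).2]

theorem absolutelyContinuousOnInterval_const_add_integral {h : ℝ → ℝ}
    (hh : IntervalIntegrable h volume 0 1) (c : ℝ) :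
    AbsolutelyContinuousOnInterval (fun x => c + ∫ t in (0 : ℝ)..x, h t) 0 1 :=
  (contDiffOn_const (c := c)).absolutelyContinuousOnInterval.add
    (hh.absolutelyContinuousOnInterval_intervalIntegral (by simp))

namespace IsTower

variable {m : ℕ} {g g' : ℕ → ℝ → ℝ}

/-- Regularity descends from the top: `g m` is in L², hence integrable, and integrability of `g (k +
1)` makes `g k` absolutely continuous, hence continuous and again integrable. -/
theorem intervalIntegrable_and (hg : IsTower m g) (j : ℕ) (hj : j ≤ m) :
    IntervalIntegrable (g j) volume 0 1 ∧
      (j < m → AbsolutelyContinuousOnInterval (g j) 0 1) := by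
  induction hj using Nat.decreasingInduction with
  | self => exact ⟨intervalIntegrable_of_memLp_two hg.2, fun h => absurd h (lt_irrefl _)⟩
  | of_succ k hk ih =>
    have hac : AbsolutelyContinuousOnInterval (g k) 0 1 := by
      refine absolutelyContinuousOnInterval_congr
        (absolutelyContinuousOnInterval_const_add_integral ih.1 (g k 0)) fun x hx => ?_
      rw [uIcc_of_le zero_le_one] at hx
      exact (hg.1 k hk x hx).symm
    exact ⟨hac.continuousOn.intervalIntegrable, fun _ => hac⟩

theorem intervalIntegrable (hg : IsTower m g) {j : ℕ} (hj : j ≤ m) :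
    IntervalIntegrable (g j) volume 0 1 := (hg.intervalIntegrable_and j hj).1

theorem absolutelyContinuous (hg : IsTower m g) {j : ℕ} (hj : j < m) :
    AbsolutelyContinuousOnInterval (g j) 0 1 := (hg.intervalIntegrable_and j hj.le).2 hj

theorem continuousOn (hg : IsTower m g) {j : ℕ} (hj : j < m) :
    ContinuousOn (g j) (Icc (0 : ℝ) 1) := by
  simpa [uIcc_of_le] using (hg.absolutelyContinuous hj).continuousOn

theorem memLp (hg : IsTower m g) {j : ℕ} (hj : j ≤ m) :
    MemLp (g j) 2 (volume.restrict (Icc (0 : ℝ) 1)) := by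
  rcases hj.lt_or_eq with h | rfl
  · exact memLp_two_of_continuousOn (hg.continuousOn h)
  · exact hg.2

theorem integrable_sub (hg : IsTower m g) {j : ℕ} (hj : j ≤ m) {x y : ℝ} (hx : x ∈ Icc (0 : ℝ) 1)
    (hy : y ∈ Icc (0 : ℝ) 1) : IntervalIntegrable (g j) volume x y :=
  (hg.intervalIntegrable hj).mono_set (by
    rw [uIcc_of_le (zero_le_one (α := ℝ))]
    exact uIcc_subset_Icc hx hy)

theorem sub_eq_integral (hg : IsTower m g) {j : ℕ} (hj : j < m) {x y : ℝ}
    (hx : x ∈ Icc (0 : ℝ) 1) (hy : y ∈ Icc (0 : ℝ) 1) :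
    g j y - g j x = ∫ t in x..y, g (j + 1) t := by
  have h0 : (0 : ℝ) ∈ Icc (0 : ℝ) 1 := by simp
  rw [hg.1 j hj x hx, hg.1 j hj y hy, ← integral_interval_sub_left (a := 0)
    (hg.integrable_sub hj h0 hy) (hg.integrable_sub hj h0 hx)]
  ring

theorem add (hg : IsTower m g) (hg' : IsTower m g') : IsTower m (fun j x => g j x + g' j x) := by
  refine ⟨fun j hj x hx => ?_, hg.2.add hg'.2⟩
  have h0 : (0 : ℝ) ∈ Icc (0 : ℝ) 1 := by simp
  rw [integral_add (hg.integrable_sub hj h0 hx) (hg'.integrable_sub hj h0 hx)]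
  linarith [hg.1 j hj x hx, hg'.1 j hj x hx]

theorem const_mul (hg : IsTower m g) (c : ℝ) : IsTower m (fun j x => c * g j x) := by
  refine ⟨fun j hj x hx => ?_, hg.2.const_mul c⟩
  simp only
  rw [intervalIntegral.integral_const_mul, hg.1 j hj x hx]
  ring

theorem zero (m : ℕ) : IsTower m (fun _ _ => 0) := by
  refine ⟨fun j hj x hx => ?_, MemLp.zero⟩
  simp

theorem sum {ι : Type*} (s : Finset ι) {G : ι → ℕ → ℝ → ℝ} (c : ι → ℝ)
    (hG : ∀ i ∈ s, IsTower m (G i)) : IsTower m (fun j x => ∑ i ∈ s, c i * G i j x) := by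
  classical
  induction s using Finset.induction_on with
  | empty => simpa using zero m
  | insert i s hi ih =>
    simp only [Finset.sum_insert hi]
    exact ((hG i (by simp)).const_mul (c i)).add (ih fun k hk => hG k (by simp [hk]))

end IsTower

theorem hasDerivWithinAt_const_add_integral {h : ℝ → ℝ} (hh : ContinuousOn h (Icc (0 : ℝ) 1))
    (c : ℝ) {x : ℝ} (hx : x ∈ Icc (0 : ℝ) 1) :
    HasDerivWithinAt (fun x => c + ∫ t in (0 : ℝ)..x, h t) (h x) (Icc 0 1) x := by
  -- Extending h by constants outside [0,1] gives a continuous function on ℝ, so the fundamental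
  -- theorem of calculus also covers the two end points.
  have hc : Continuous (IccExtend (zero_le_one (α := ℝ)) ((Icc (0 : ℝ) 1).domRestrict h)) :=
    hh.domRestrict.Icc_extend'
  have hd := (hc.integral_hasStrictDerivAt 0 x).hasDerivAt.hasDerivWithinAt (s := Icc (0 : ℝ) 1)
  have he : ∀ y ∈ Icc (0 : ℝ) 1,
      IccExtend (zero_le_one (α := ℝ)) ((Icc (0 : ℝ) 1).domRestrict h) y = h y := fun y hy => by
    rw [IccExtend_of_mem _ _ hy]; rfl
  have hd' := hd.const_add c
  rw [he x hx] at hd'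
  refine hd'.congr_of_mem (fun y hy => ?_) hx
  congr 1
  refine integral_congr fun t ht => (he t ?_).symm
  rw [uIcc_of_le hy.1] at ht
  exact ⟨ht.1, ht.2.trans hy.2⟩

theorem deriv01_succ (j : ℕ) (f : unitInterval → ℝ) (x : ℝ) :
    deriv01 (j + 1) f x = derivWithin (deriv01 j f) (Icc (0 : ℝ) 1) x := by
  unfold deriv01
  rw [iteratedDerivWithin_succ]

theorem deriv01_order_zero (f : unitInterval → ℝ) {x : ℝ} (hx : x ∈ Icc (0 : ℝ) 1) :
    deriv01 0 f x = f ⟨x, hx⟩ := by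
  unfold deriv01
  rw [iteratedDerivWithin_zero, IccExtend_of_mem _ _ hx]

/-- The derivatives of a function are the members of any tower above it. -/
theorem IsTower.deriv01_eq {m : ℕ} {g : ℕ → ℝ → ℝ} (hg : IsTower m g) {f : unitInterval → ℝ}
    (hf : ∀ x : unitInterval, f x = g 0 x) :
    ∀ j < m, ∀ x ∈ Icc (0 : ℝ) 1, deriv01 j f x = g j x := by
  intro j
  induction j with
  | zero => intro _ x hx; rw [deriv01_order_zero f hx, hf]
  | succ j ih =>
    intro hj x hx
    rw [deriv01_succ]
    have hd := hasDerivWithinAt_const_add_integral (hg.continuousOn hj) (g j 0) hx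
    have he : HasDerivWithinAt (deriv01 j f) (g (j + 1) x) (Icc 0 1) x := by
      refine hd.congr_of_mem (fun y hy => ?_) hx
      rw [ih (by omega) y hy, hg.1 j (by omega) y hy]
    exact he.derivWithin (uniqueDiffOn_Icc zero_lt_one x hx)

/-- The top member is only integrable, so Lebesgue differentiation yields the m-th derivative almost
everywhere; the lower members are recovered at every point. -/
theorem IsTower.deriv01_ae_eq {m : ℕ} {g : ℕ → ℝ → ℝ} (hg : IsTower m g) {f : unitInterval → ℝ}
    (hf : ∀ x : unitInterval, f x = g 0 x) :
    deriv01 m f =ᵐ[volume.restrict (Icc (0 : ℝ) 1)] g m := by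
  cases m with
  | zero =>
    filter_upwards [ae_restrict_mem measurableSet_Icc] with x hx
    rw [deriv01_order_zero f hx, hf]
  | succ m =>
    have h1 := ae_restrict_of_ae (s := Icc (0 : ℝ) 1)
      (hg.intervalIntegrable le_rfl).ae_hasDerivAt_integral
    filter_upwards [h1, ae_restrict_mem measurableSet_Icc] with x hx hx1
    have hd := (hx (by rwa [uIcc_of_le zero_le_one]) 0 (by simp)).const_add (g m 0)
    rw [deriv01_succ]
    have he : HasDerivWithinAt (deriv01 m f) (g (m + 1) x) (Icc 0 1) x := by
      refine hd.hasDerivWithinAt.congr_of_mem (fun y hy => ?_) hx1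
      rw [hg.deriv01_eq hf m (by omega) y hy, hg.1 m (by omega) y hy]
    exact he.derivWithin (uniqueDiffOn_Icc zero_lt_one x hx1)

theorem IsTower.mem_sobolev {m : ℕ} {g : ℕ → ℝ → ℝ} (hg : IsTower m g) {f : unitInterval → ℝ}
    (hf : ∀ x : unitInterval, f x = g 0 x) : f ∈ sobolev m := by
  refine ⟨fun j hj => ?_, (memLp_congr_ae (hg.deriv01_ae_eq hf)).2 hg.2⟩
  refine absolutelyContinuousOnInterval_congr (hg.absolutelyContinuous hj) fun x hx => ?_
  rw [uIcc_of_le zero_le_one] at hx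
  exact (hg.deriv01_eq hf j hj x hx).symm

/-- The fundamental theorem of calculus for absolutely continuous functions, together with
`IsTower.mem_sobolev`, makes S^m the set of bottoms of towers. Sums, Taylor remainders and limits
are then handled through integrals. -/
theorem isTower_of_mem_sobolev {m : ℕ} {f : unitInterval → ℝ} (hf : f ∈ sobolev m) :
    IsTower m (fun j => deriv01 j f) := by
  refine ⟨fun j hj x hx => ?_, hf.2⟩
  have hac := (hf.1 j hj).mono (c := 0) (d := x) (by
    rw [uIcc_of_le hx.1, uIcc_of_le zero_le_one]; exact Icc_subset_Icc_right hx.2)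
  have h1 := hac.integral_deriv_eq_sub
  have h2 : ∫ t in (0 : ℝ)..x, deriv01 (j + 1) f t = ∫ t in (0 : ℝ)..x, deriv (deriv01 j f) t := by
    rw [integral_of_le hx.1, integral_of_le hx.1, ← integral_Icc_eq_integral_Ioc,
      ← integral_Icc_eq_integral_Ioc, integral_Icc_eq_integral_Ioo, integral_Icc_eq_integral_Ioo]
    refine setIntegral_congr_fun measurableSet_Ioo fun t ht => ?_
    rw [deriv01_succ]
    exact derivWithin_of_mem_nhds (Icc_mem_nhds ht.1 (ht.2.trans_le hx.2))
  simp only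
  rw [h2, h1]
  ring

theorem deriv01_zero_apply (f : unitInterval → ℝ) (x : unitInterval) : f x = deriv01 0 f x := by
  rw [deriv01_order_zero f x.2]

theorem IsTower.mono {m k : ℕ} {g : ℕ → ℝ → ℝ} (hg : IsTower m g) (hk : k ≤ m) : IsTower k g :=
  ⟨fun j hj x hx => hg.1 j (hj.trans_le hk) x hx, hg.memLp hk⟩

theorem sobolev_mono {m k : ℕ} (hk : k ≤ m) : sobolev m ⊆ sobolev k := fun f hf =>
  ((isTower_of_mem_sobolev hf).mono hk).mem_sobolev (deriv01_zero_apply f)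

theorem continuous_of_mem_sobolev {m : ℕ} (hm : 1 ≤ m) {f : unitInterval → ℝ}
    (hf : f ∈ sobolev m) : Continuous f := by
  have h := (isTower_of_mem_sobolev hf).continuousOn (j := 0) hm
  have : f = (Icc (0 : ℝ) 1).domRestrict (deriv01 0 f) := by
    ext x; exact deriv01_zero_apply f x
  rw [this]
  exact h.domRestrict

/-- Linear combinations in the Sobolev space. -/
theorem sum_mem_sobolev {m : ℕ} {ι : Type*} (s : Finset ι) {f : ι → unitInterval → ℝ} (c : ι → ℝ)
    (hf : ∀ i ∈ s, f i ∈ sobolev m) : (fun t => ∑ i ∈ s, c i * f i t) ∈ sobolev m :=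
  (IsTower.sum s c fun i hi => isTower_of_mem_sobolev (hf i hi)).mem_sobolev fun x => by
    exact Finset.sum_congr rfl fun i _ => by rw [← deriv01_zero_apply]

theorem deriv01_sum_ae {m : ℕ} {ι : Type*} (s : Finset ι) {f : ι → unitInterval → ℝ} (c : ι → ℝ)
    (hf : ∀ i ∈ s, f i ∈ sobolev m) :
    deriv01 m (fun t => ∑ i ∈ s, c i * f i t) =ᵐ[volume.restrict (Icc (0 : ℝ) 1)]
      fun x => ∑ i ∈ s, c i * deriv01 m (f i) x :=
  (IsTower.sum s c fun i hi => isTower_of_mem_sobolev (hf i hi)).deriv01_ae_eq fun x => by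
    exact Finset.sum_congr rfl fun i _ => by rw [← deriv01_zero_apply]

/-- The `k`-fold indefinite integral of `h`. -/
noncomputable def iterInt : ℕ → (ℝ → ℝ) → ℝ → ℝ
  | 0, h => h
  | k + 1, h => fun x => ∫ t in (0 : ℝ)..x, iterInt k h t

theorem isTower_iterInt (m : ℕ) {h : ℝ → ℝ} (hh : MemLp h 2 (volume.restrict (Icc (0 : ℝ) 1))) :
    IsTower m (fun j => iterInt (m - j) h) := by
  refine ⟨fun j hj x hx => ?_, by simpa [iterInt] using hh⟩
  obtain ⟨k, rfl⟩ : ∃ k, m = j + 1 + k := ⟨m - (j + 1), by omega⟩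
  simp only
  rw [show j + 1 + k - j = k + 1 by omega, show j + 1 + k - (j + 1) = k by omega]
  simp [iterInt]

/-! ### The weight and the form V -/

/-- The weight `A''(f₀) p` of the form `V` is measurable, bounded, and bounded away from `0`. -/
structure WeightBounds (A : ℝ → ℝ) (f₀ p : unitInterval → ℝ) (c₁ c₂ : ℝ) : Prop where
  meas : Measurable fun x => iteratedDeriv 2 A (f₀ x) * p x
  pos : 0 < c₁
  lower : ∀ x, c₁ ≤ iteratedDeriv 2 A (f₀ x) * p x
  upper : ∀ x, iteratedDeriv 2 A (f₀ x) * p x ≤ c₂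

theorem integral_unitInterval_eq {F : unitInterval → ℝ} {G : ℝ → ℝ} (h : ∀ x, F x = G x) :
    ∫ x, F x = ∫ x in (0 : ℝ)..1, G x := by
  rw [integral_of_le zero_le_one, ← integral_Icc_eq_integral_Ioc,
    ← integral_subtype measurableSet_Icc]
  exact integral_congr_ae (Eventually.of_forall h)

theorem integrable_of_continuous {F : unitInterval → ℝ} (hF : Continuous F) : Integrable F := by
  simpa using (hF.continuousOn (s := univ)).integrableOn_compact (μ := volume) isCompact_univ

theorem formV_eq (A : ℝ → ℝ) (f₀ p g h : unitInterval → ℝ) :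
    formV A f₀ p g h = ∫ x, iteratedDeriv 2 A (f₀ x) * p x * (g x * h x) := by
  unfold formV
  congr 1
  ext x
  ring

theorem formV_comm (A : ℝ → ℝ) (f₀ p g h : unitInterval → ℝ) :
    formV A f₀ p g h = formV A f₀ p h g := by
  simp only [formV_eq, mul_comm (g _)]

namespace WeightBounds

variable {A : ℝ → ℝ} {f₀ p : unitInterval → ℝ} {c₁ c₂ : ℝ}

theorem nonneg (W : WeightBounds A f₀ p c₁ c₂) (x : unitInterval) :
    0 ≤ iteratedDeriv 2 A (f₀ x) * p x := W.pos.le.trans (W.lower x)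

theorem c₂_pos (W : WeightBounds A f₀ p c₁ c₂) : 0 < c₂ :=
  W.pos.trans_le ((W.lower 0).trans (W.upper 0))

theorem norm_le (W : WeightBounds A f₀ p c₁ c₂) (x : unitInterval) :
    ‖iteratedDeriv 2 A (f₀ x) * p x‖ ≤ c₂ := by
  rw [Real.norm_of_nonneg (W.nonneg x)]
  exact W.upper x

theorem integrable (W : WeightBounds A f₀ p c₁ c₂) {F : unitInterval → ℝ} (hF : Continuous F) :
    Integrable fun x => iteratedDeriv 2 A (f₀ x) * p x * F x := by
  exact (integrable_of_continuous hF).bdd_mul W.meas.aestronglyMeasurable (Eventually.of_forall W.norm_le)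

theorem formV_sum_left (W : WeightBounds A f₀ p c₁ c₂) {ι : Type*} (s : Finset ι)
    {f : ι → unitInterval → ℝ} (c : ι → ℝ) {g : unitInterval → ℝ}
    (hf : ∀ i ∈ s, Continuous (f i)) (hg : Continuous g) :
    formV A f₀ p (fun t => ∑ i ∈ s, c i * f i t) g = ∑ i ∈ s, c i * formV A f₀ p (f i) g := by
  simp only [formV_eq]
  simp_rw [Finset.sum_mul, Finset.mul_sum]
  rw [MeasureTheory.integral_finsetSum]
  · refine Finset.sum_congr rfl fun i _ => ?_
    rw [← MeasureTheory.integral_const_mul]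
    congr 1
    ext x
    ring
  · intro i hi
    have := (W.integrable ((hf i hi).mul hg)).const_mul (c i)
    refine this.congr (Eventually.of_forall fun x => ?_)
    simp only [Pi.mul_apply]
    ring

theorem formV_sub_left (W : WeightBounds A f₀ p c₁ c₂) {f g h : unitInterval → ℝ}
    (hf : Continuous f) (hg : Continuous g) (hh : Continuous h) :
    formV A f₀ p (f - g) h = formV A f₀ p f h - formV A f₀ p g h := by
  simp only [formV_eq]
  rw [← MeasureTheory.integral_sub (W.integrable (F := fun x => f x * h x) (hf.mul hh))
    (W.integrable (F := fun x => g x * h x) (hg.mul hh))]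
  congr 1
  ext x
  simp only [Pi.sub_apply]
  ring

theorem abs_formV_le (W : WeightBounds A f₀ p c₁ c₂) {f g : unitInterval → ℝ} {a b : ℝ}
    (hf : ∀ x, |f x| ≤ a) (hg : ∀ x, |g x| ≤ b) : |formV A f₀ p f g| ≤ c₂ * (a * b) := by
  rw [formV_eq]
  have h := norm_integral_le_of_norm_le_const (μ := (volume : Measure unitInterval))
    (f := fun x => iteratedDeriv 2 A (f₀ x) * p x * (f x * g x)) (C := c₂ * (a * b))
    (Eventually.of_forall fun x => ?_)
  · simpa using h
  · rw [norm_mul]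
    refine mul_le_mul (W.norm_le x) ?_ (norm_nonneg _) W.c₂_pos.le
    rw [norm_mul]
    exact mul_le_mul (hf x) (hg x) (norm_nonneg _) ((abs_nonneg _).trans (hf x))

theorem formV_self_le (W : WeightBounds A f₀ p c₁ c₂) {f : unitInterval → ℝ}
    (hf : Continuous f) : formV A f₀ p f f ≤ c₂ * ∫ x, f x ^ 2 := by
  rw [formV_eq, ← MeasureTheory.integral_const_mul]
  have hi := integrable_of_continuous (F := fun x => f x ^ 2) (by fun_prop)
  refine integral_mono (W.integrable (hf.mul hf)) (hi.const_mul c₂) fun x => ?_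
  simp only
  rw [← sq]
  exact mul_le_mul_of_nonneg_right (W.upper x) (sq_nonneg _)

end WeightBounds

/-! ### Integration by parts -/

theorem integral_deriv01_mul_deriv01 {m j k : ℕ} {f g : unitInterval → ℝ} {l : ℕ}
    (hf : f ∈ sobolev m) (hg : g ∈ sobolev l) (hj : j < m) (hk : k < l)
    (h0 : deriv01 k g 0 = 0) (h1 : deriv01 k g 1 = 0) :
    ∫ x in (0 : ℝ)..1, deriv01 (j + 1) f x * deriv01 k g x =
      -∫ x in (0 : ℝ)..1, deriv01 j f x * deriv01 (k + 1) g x := by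
  have key : ∀ (F G : ℝ → ℝ), (∀ x ∈ Ioo (0 : ℝ) 1, F x = G x) →
      ∫ x in (0 : ℝ)..1, F x = ∫ x in (0 : ℝ)..1, G x := fun F G h => by
    rw [integral_of_le zero_le_one, integral_of_le zero_le_one, integral_Ioc_eq_integral_Ioo,
      integral_Ioc_eq_integral_Ioo]
    exact setIntegral_congr_fun measurableSet_Ioo h
  have hd : ∀ (i : ℕ) (u : unitInterval → ℝ), ∀ x ∈ Ioo (0 : ℝ) 1,
      deriv01 (i + 1) u x = deriv (deriv01 i u) x := fun i u x hx => by
    rw [deriv01_succ]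
    exact derivWithin_of_mem_nhds (Icc_mem_nhds hx.1 hx.2)
  rw [key (fun x => deriv01 (j + 1) f x * deriv01 k g x)
      (fun x => deriv (deriv01 j f) x * deriv01 k g x) fun x hx => by simp only [hd j f x hx],
    key (fun x => deriv01 j f x * deriv01 (k + 1) g x)
      (fun x => deriv01 j f x * deriv (deriv01 k g) x) fun x hx => by simp only [hd k g x hx],
    (hf.1 j hj).integral_mul_deriv_eq_deriv_mul (hg.1 k hk), h0, h1]
  ring

/-- Derivatives are moved one by one from f to ψ. The boundary terms vanish by the conditions on ψ
alone, so f is any element of S^m; after m moves the equation for ψ^(2m) applies, and the two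
factors (-1)^m cancel. -/
theorem formU_eq_of_solvesODE {m : ℕ} {A : ℝ → ℝ} {f₀ p f ψ : unitInterval → ℝ} {r : ℝ}
    (hf : f ∈ sobolev m) (hψ : SolvesODE m A f₀ p ψ r) :
    formU m f ψ = r * formV A f₀ p f ψ := by
  have hk : ∀ k ≤ m, formU m f ψ =
      (-1) ^ k * ∫ x in (0 : ℝ)..1, deriv01 (m - k) f x * deriv01 (m + k) ψ x := by
    intro k
    induction k with
    | zero => intro _; simp [formU]
    | succ k ih =>
      intro hk
      rw [ih (by omega)]
      have hb := hψ.2.2 (m + k) (by omega) (by omega)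
      have := integral_deriv01_mul_deriv01 (j := m - (k + 1)) (k := m + k) hf hψ.1 (by omega)
        (by omega) hb.1 hb.2
      rw [show m - (k + 1) + 1 = m - k by omega] at this
      rw [this, pow_succ, add_assoc]
      ring
  rw [hk m le_rfl, Nat.sub_self, ← two_mul, ← integral_unitInterval_eq
    (F := fun x => f x * deriv01 (2 * m) ψ x) (fun x => by rw [deriv01_zero_apply f x]),
    ← MeasureTheory.integral_const_mul]
  unfold formV
  rw [← MeasureTheory.integral_const_mul]
  refine integral_congr_ae ?_
  filter_upwards [hψ.2.1] with x hx
  linear_combination f x * hx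

/-! ### A Poincaré inequality -/

/-- A member vanishing at a is bounded by the integral of the absolute value of the next one. Each
integration after the first costs the length b - a of the interval. -/
theorem IsTower.abs_le_integral {m : ℕ} {g : ℕ → ℝ → ℝ} (hg : IsTower m g) {a b : ℝ}
    (ha : a ∈ Icc (0 : ℝ) 1) (hb : b ∈ Icc (0 : ℝ) 1) (hab : a ≤ b)
    (h0 : ∀ j < m, g j a = 0) :
    ∀ i < m, ∀ x ∈ Icc a b, |g (m - 1 - i) x| ≤ (b - a) ^ i * ∫ t in a..b, |g m t| := by
  have step : ∀ j < m, ∀ x ∈ Icc a b, |g j x| ≤ ∫ t in a..b, |g (j + 1) t| := fun j hj x hx => by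
    have hx1 : x ∈ Icc (0 : ℝ) 1 := ⟨ha.1.trans hx.1, hx.2.trans hb.2⟩
    have := hg.sub_eq_integral hj ha hx1
    rw [h0 j hj, sub_zero] at this
    rw [this]
    refine (abs_integral_le_integral_abs hx.1).trans ?_
    refine integral_mono_interval le_rfl hx.1 hx.2
      (Eventually.of_forall fun t => abs_nonneg _) ?_
    exact (hg.integrable_sub hj ha hb).abs
  intro i
  induction i with
  | zero =>
    intro hi x hx
    have := step (m - 1) (by omega) x hx
    rw [show m - 1 + 1 = m by omega] at this
    simpa using this
  | succ i ih =>
    intro hi x hx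
    refine (step (m - 1 - (i + 1)) (by omega) x hx).trans ?_
    rw [show m - 1 - (i + 1) + 1 = m - 1 - i by omega]
    have h1 := integral_mono_on hab ((hg.integrable_sub (j := m - 1 - i) (by omega) ha hb).abs)
      (intervalIntegrable_const (c := (b - a) ^ i * ∫ t in a..b, |g m t|)) (ih (by omega))
    refine h1.trans_eq ?_
    rw [intervalIntegral.integral_const, smul_eq_mul]
    ring

theorem sq_integral_abs_le {h : ℝ → ℝ} (hh : MemLp h 2 (volume.restrict (Icc (0 : ℝ) 1)))
    {a b : ℝ} (ha : a ∈ Icc (0 : ℝ) 1) (hb : b ∈ Icc (0 : ℝ) 1) (hab : a ≤ b) :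
    (∫ t in a..b, |h t|) ^ 2 ≤ (b - a) * ∫ t in a..b, h t ^ 2 := by
  rcases hab.eq_or_lt with rfl | hlt
  · simp
  have hsub : uIcc a b ⊆ uIcc 0 1 := by
    rw [uIcc_of_le (zero_le_one (α := ℝ))]
    exact uIcc_subset_Icc ha hb
  have h1 : IntervalIntegrable (fun t => |h t|) volume a b :=
    ((intervalIntegrable_of_memLp_two hh).mono_set hsub).abs
  have h2 : IntervalIntegrable (fun t => h t ^ 2) volume a b := by
    refine IntervalIntegrable.mono_set ?_ hsub
    rw [intervalIntegrable_iff_integrableOn_Icc_of_le zero_le_one]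
    exact hh.integrable_sq
  set S := ∫ t in a..b, |h t| with hS
  -- The mean of |h| over [a, b]: nonnegativity of the integral of (|h| - c)² is the Cauchy–Schwarz
  -- inequality sought.
  set c := S / (b - a) with hc
  have h3 : 0 ≤ ∫ t in a..b, (|h t| - c) ^ 2 := integral_nonneg hab fun t _ => sq_nonneg _
  have h4 : ∫ t in a..b, (|h t| - c) ^ 2 =
      (∫ t in a..b, h t ^ 2) - 2 * c * S + (b - a) * c ^ 2 := by
    have : ∀ t, (|h t| - c) ^ 2 = h t ^ 2 - 2 * c * |h t| + c ^ 2 := fun t => by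
      rw [sub_sq, sq_abs]; ring
    simp_rw [this]
    rw [integral_add (h2.sub (h1.const_mul _)) intervalIntegrable_const,
      integral_sub h2 (h1.const_mul _), intervalIntegral.integral_const_mul,
      intervalIntegral.integral_const, smul_eq_mul]
  have hpos : 0 < b - a := sub_pos.2 hlt
  have hcS : (b - a) * c = S := by rw [hc]; field_simp
  rw [h4] at h3
  nlinarith [mul_nonneg hpos.le h3]

theorem IsTower.integral_sq_le {m : ℕ} (hm : 1 ≤ m) {g : ℕ → ℝ → ℝ} (hg : IsTower m g) {a b : ℝ}
    (ha : a ∈ Icc (0 : ℝ) 1) (hb : b ∈ Icc (0 : ℝ) 1) (hab : a ≤ b)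
    (h0 : ∀ j < m, g j a = 0) :
    ∫ x in a..b, g 0 x ^ 2 ≤ (b - a) ^ (2 * m) * ∫ x in a..b, g m x ^ 2 := by
  have h1 : ∀ x ∈ Icc a b, g 0 x ^ 2 ≤ (b - a) ^ (2 * m - 1) * ∫ x in a..b, g m x ^ 2 := by
    intro x hx
    have h2 := hg.abs_le_integral ha hb hab h0 (m - 1) (by omega) x hx
    rw [Nat.sub_self] at h2
    have h3 := sq_integral_abs_le hg.2 ha hb hab
    calc g 0 x ^ 2 = |g 0 x| ^ 2 := (sq_abs _).symm
      _ ≤ ((b - a) ^ (m - 1) * ∫ t in a..b, |g m t|) ^ 2 :=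
        pow_le_pow_left₀ (abs_nonneg _) h2 2
      _ = ((b - a) ^ (m - 1)) ^ 2 * (∫ t in a..b, |g m t|) ^ 2 := by ring
      _ ≤ ((b - a) ^ (m - 1)) ^ 2 * ((b - a) * ∫ t in a..b, g m t ^ 2) :=
        mul_le_mul_of_nonneg_left h3 (sq_nonneg _)
      _ = _ := by
        rw [← pow_mul, ← mul_assoc, ← pow_succ]
        congr 2
        omega
  have hi : IntervalIntegrable (fun x => g 0 x ^ 2) volume a b := by
    refine ContinuousOn.intervalIntegrable ((hg.continuousOn (j := 0) hm).pow 2 |>.mono ?_)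
    exact uIcc_subset_Icc ha hb
  refine (integral_mono_on hab hi intervalIntegrable_const h1).trans_eq ?_
  rw [intervalIntegral.integral_const, smul_eq_mul, ← mul_assoc, ← pow_succ']
  congr 2
  omega

/-- The estimate on one interval is summed over the K cells of length 1/K. Vanishing is required
only at left end points, so mK linear conditions buy the factor K^(-2m). -/
theorem IsTower.integral_sq_le_of_grid {m : ℕ} (hm : 1 ≤ m) {g : ℕ → ℝ → ℝ} (hg : IsTower m g)
    {K : ℕ} (hK : 1 ≤ K) (h0 : ∀ k < K, ∀ j < m, g j (k / K) = 0) :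
    ∫ x in (0 : ℝ)..1, g 0 x ^ 2 ≤ (1 / (K : ℝ)) ^ (2 * m) * ∫ x in (0 : ℝ)..1, g m x ^ 2 := by
  have hK0 : (0 : ℝ) < K := by exact_mod_cast hK
  have hmem : ∀ k ≤ K, (k / K : ℝ) ∈ Icc (0 : ℝ) 1 := fun k hk =>
    ⟨by positivity, div_le_one_of_le₀ (by exact_mod_cast hk) hK0.le⟩
  have hsub : ∀ k < K, uIcc (k / K : ℝ) ((k + 1 : ℕ) / K) ⊆ uIcc 0 1 := fun k hk => by
    rw [uIcc_of_le (zero_le_one (α := ℝ))]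
    exact uIcc_subset_Icc (hmem k hk.le) (hmem (k + 1) hk)
  have hsq : ∀ j ≤ m, IntervalIntegrable (fun x => g j x ^ 2) volume 0 1 := fun j hj => by
    rw [intervalIntegrable_iff_integrableOn_Icc_of_le zero_le_one]
    exact (hg.memLp hj).integrable_sq
  have hsum : ∀ j ≤ m, ∑ k ∈ Finset.range K, ∫ x in (k / K : ℝ)..((k + 1 : ℕ) / K), g j x ^ 2 =
      ∫ x in (0 : ℝ)..1, g j x ^ 2 := fun j hj => by
    have := sum_integral_adjacent_intervals (f := fun x => g j x ^ 2) (μ := volume)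
      (a := fun k : ℕ => (k / K : ℝ)) (n := K)
      fun k hk => (hsq j hj).mono_set (hsub k hk)
    rw [this]
    congr 1
    · simp
    · field_simp
  rw [← hsum 0 (Nat.zero_le _), ← hsum m le_rfl, Finset.mul_sum]
  refine Finset.sum_le_sum fun k hk => ?_
  rw [Finset.mem_range] at hk
  have hle : (k / K : ℝ) ≤ (k + 1 : ℕ) / K := by
    push_cast
    gcongr
    linarith
  refine (hg.integral_sq_le hm (hmem k hk.le) (hmem (k + 1) hk) hle (h0 k hk)).trans_eq ?_
  congr 2
  push_cast
  field_simp
  ring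

/-! ### The null space of U -/

theorem sub_mem_sobolev {m : ℕ} {f g : unitInterval → ℝ} (hf : f ∈ sobolev m)
    (hg : g ∈ sobolev m) :
    f - g ∈ sobolev m ∧ deriv01 m (f - g) =ᵐ[volume.restrict (Icc (0 : ℝ) 1)]
      fun x => deriv01 m f x - deriv01 m g x := by
  have h := (isTower_of_mem_sobolev hf).add ((isTower_of_mem_sobolev hg).const_mul (-1))
  have h0 : ∀ x : unitInterval, (f - g) x = deriv01 0 f x + -1 * deriv01 0 g x := fun x => by
    rw [← deriv01_zero_apply, ← deriv01_zero_apply, Pi.sub_apply]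
    ring
  refine ⟨h.mem_sobolev h0, (h.deriv01_ae_eq h0).trans (Eventually.of_forall fun x => ?_)⟩
  simp only
  ring

theorem intervalIntegral_congr_ae_Icc {F G : ℝ → ℝ}
    (h : F =ᵐ[volume.restrict (Icc (0 : ℝ) 1)] G) :
    ∫ x in (0 : ℝ)..1, F x = ∫ x in (0 : ℝ)..1, G x := by
  rw [integral_of_le zero_le_one, integral_of_le zero_le_one, ← integral_Icc_eq_integral_Ioc,
    ← integral_Icc_eq_integral_Ioc]
  exact MeasureTheory.integral_congr_ae h

theorem formU_sum_right {m : ℕ} {ι : Type*} (s : Finset ι) {f : ι → unitInterval → ℝ} (c : ι → ℝ)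
    {g : unitInterval → ℝ} (hf : ∀ i ∈ s, f i ∈ sobolev m) (hg : g ∈ sobolev m) :
    formU m g (fun t => ∑ i ∈ s, c i * f i t) = ∑ i ∈ s, c i * formU m g (f i) := by
  unfold formU
  rw [intervalIntegral_congr_ae_Icc (G := fun x => ∑ i ∈ s, c i * (deriv01 m g x * deriv01 m (f i) x))]
  · rw [intervalIntegral.integral_finsetSum]
    · simp only [intervalIntegral.integral_const_mul]
    · intro i hi
      refine IntervalIntegrable.const_mul ?_ _
      rw [intervalIntegrable_iff_integrableOn_Icc_of_le zero_le_one]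
      exact hg.2.integrable_mul (hf i hi).2
  · filter_upwards [deriv01_sum_ae s c hf] with x hx
    rw [hx, Finset.mul_sum]
    exact Finset.sum_congr rfl fun i _ => by ring

theorem deriv01_ae_zero_of_mem_nullSpace {m : ℕ} {g : unitInterval → ℝ} (hg : g ∈ nullSpace m) :
    deriv01 m g =ᵐ[volume.restrict (Icc (0 : ℝ) 1)] fun _ => 0 := by
  have h := hg.2
  unfold formU at h
  rw [integral_of_le zero_le_one, ← integral_Icc_eq_integral_Ioc,
    integral_eq_zero_iff_of_nonneg (fun x => mul_self_nonneg _)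
      (hg.1.2.integrable_mul hg.1.2)] at h
  filter_upwards [h] with x hx
  simpa using hx

theorem mem_nullSpace_iff {m : ℕ} {g : unitInterval → ℝ} :
    g ∈ nullSpace m ↔
      g ∈ sobolev m ∧ deriv01 m g =ᵐ[volume.restrict (Icc (0 : ℝ) 1)] fun _ => 0 := by
  refine ⟨fun h => ⟨h.1, deriv01_ae_zero_of_mem_nullSpace h⟩, fun h => ⟨h.1, ?_⟩⟩
  unfold formU
  rw [intervalIntegral_congr_ae_Icc (G := fun _ => 0)]
  · simp
  · filter_upwards [h.2] with x hx
    simp [hx]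

/-- Through this, exhaustiveness of the eigensystem applies to the whole null space. -/
theorem solvesODE_of_mem_nullSpace {m : ℕ} (A : ℝ → ℝ) (f₀ p : unitInterval → ℝ)
    {g : unitInterval → ℝ} (hm : 1 ≤ m) (hg : g ∈ nullSpace m) : SolvesODE m A f₀ p g 0 := by
  have h0 := deriv01_ae_zero_of_mem_nullSpace hg
  -- Membership gives g^(m) = 0 only almost everywhere, while the boundary conditions concern
  -- points. Cutting the tower off at order m yields derivatives that vanish identically: `g^(m-1)`
  -- is constant because its increment is the integral of an almost everywhere zero function.
  have ht : IsTower (2 * m) (fun j x => if j < m then deriv01 j g x else 0) := by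
    refine ⟨fun j hj x hx => ?_, ?_⟩
    · have hx0 : uIcc 0 x ⊆ Icc (0 : ℝ) 1 := uIcc_subset_Icc (by simp) hx
      rcases lt_or_ge j m with hjm | hjm
      · have h1 := (isTower_of_mem_sobolev hg.1).1 j hjm x hx
        by_cases hj1 : j + 1 < m
        · simpa [hjm, hj1] using h1
        · have hj2 : j + 1 = m := by omega
          have : ∫ t in (0 : ℝ)..x, deriv01 (j + 1) g t = 0 := by
            rw [hj2, integral_of_le hx.1, ← integral_Icc_eq_integral_Ioc,
              MeasureTheory.integral_congr_ae
                (ae_restrict_of_ae_restrict_of_subset (Icc_subset_Icc_right hx.2) h0)]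
            simp
          simp only [hjm, hj1, if_true, if_false]
          simp only at h1
          rw [h1, this]
          simp
      · have : ¬ j < m := by omega
        have : ¬ j + 1 < m := by omega
        simp [*]
    · have : ¬ 2 * m < m := by omega
      simp only [this, if_false]
      exact MemLp.zero
  have hg0 : ∀ x : unitInterval, g x = if 0 < m then deriv01 0 g x else 0 := fun x => by
    rw [if_pos (by omega), ← deriv01_zero_apply]
  refine ⟨ht.mem_sobolev hg0, ?_, fun j hj hj2 => ?_⟩
  · have := ht.deriv01_ae_eq hg0
    rw [EventuallyEq, ae_restrict_iff_subtype measurableSet_Icc] at this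
    filter_upwards [this] with x hx
    rw [hx, if_neg (by omega)]
    simp
  · have h := ht.deriv01_eq hg0 j hj2
    have hjm : ¬ j < m := by omega
    exact ⟨by simpa [hjm] using h 0 (by simp), by simpa [hjm] using h 1 (by simp)⟩

theorem pow_mem_nullSpace {m k : ℕ} (hk : k < m) :
    (fun t : unitInterval => (t : ℝ) ^ k) ∈ nullSpace m := by
  have ht : IsTower m (fun j x => (k.descFactorial j : ℝ) * x ^ (k - j)) := by
    refine ⟨fun j hj x hx => ?_, ?_⟩
    · simp only
      rw [intervalIntegral.integral_const_mul, integral_pow, Nat.descFactorial_succ]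
      rcases lt_or_ge j k with h | h
      · obtain ⟨i, rfl⟩ : ∃ i, k = j + 1 + i := ⟨k - (j + 1), by omega⟩
        rw [show j + 1 + i - j = i + 1 by omega, show j + 1 + i - (j + 1) = i by omega]
        push_cast
        have : (i : ℝ) + 1 ≠ 0 := by positivity
        field_simp
        ring
      · simp [Nat.sub_eq_zero_of_le h]
    · simp only [Nat.descFactorial_eq_zero_iff_lt.2 hk, Nat.cast_zero, zero_mul]
      exact MemLp.zero
  have h0 : ∀ x : unitInterval, (x : ℝ) ^ k = (k.descFactorial 0 : ℝ) * (x : ℝ) ^ (k - 0) :=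
    fun x => by simp
  refine mem_nullSpace_iff.2 ⟨ht.mem_sobolev h0, (ht.deriv01_ae_eq h0).trans ?_⟩
  simp only [Nat.descFactorial_eq_zero_iff_lt.2 hk, Nat.cast_zero, zero_mul]
  rfl

theorem linearIndependent_pow_unitInterval (m : ℕ) :
    LinearIndependent ℝ (fun (k : Fin m) (t : unitInterval) => (t : ℝ) ^ (k : ℕ)) := by
  rw [Fintype.linearIndependent_iff]
  intro c hc
  set P : Polynomial ℝ := ∑ i : Fin m, Polynomial.monomial (i : ℕ) (c i) with hP
  have hroot : P = 0 := by
    refine Polynomial.eq_zero_of_infinite_isRoot P ((Icc_infinite (zero_lt_one (α := ℝ))).mono ?_)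
    intro x hx
    have := congrFun hc ⟨x, hx⟩
    simpa [hP, Polynomial.eval_finsetSum] using this
  intro i
  have := congrArg (fun Q => Polynomial.coeff Q i) hroot
  simpa [hP, Polynomial.coeff_monomial, Fin.val_inj] using this

/-! ### Eigenvalue growth, and the first m eigenfunctions as a basis of the null space -/

namespace IsEigensystem

variable {m : ℕ} {A : ℝ → ℝ} {f₀ p : unitInterval → ℝ} {φ : ℕ → unitInterval → ℝ} {ρ : ℕ → ℝ}
  {c₁ c₂ : ℝ}

theorem mem_sobolev (E : IsEigensystem m A f₀ p φ ρ) (ν : ℕ) : φ ν ∈ sobolev m :=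
  sobolev_mono (by omega) (E.solves ν).1

theorem continuous (E : IsEigensystem m A f₀ p φ ρ) (hm : 1 ≤ m) (ν : ℕ) : Continuous (φ ν) :=
  continuous_of_mem_sobolev hm (E.mem_sobolev ν)

theorem formU_apply (E : IsEigensystem m A f₀ p φ ρ) (μ ν : ℕ) :
    formU m (φ μ) (φ ν) = if μ = ν then ρ ν else 0 := by
  rw [formU_eq_of_solvesODE (E.mem_sobolev μ) (E.solves ν), E.orthonormal]
  split_ifs <;> simp

theorem rho_nonneg (E : IsEigensystem m A f₀ p φ ρ) (ν : ℕ) : 0 ≤ ρ ν := by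
  have h := E.formU_apply ν ν
  rw [if_pos rfl] at h
  rw [← h]
  exact integral_nonneg zero_le_one fun x _ => mul_self_nonneg _

theorem formV_sum (E : IsEigensystem m A f₀ p φ ρ) (hm : 1 ≤ m) (W : WeightBounds A f₀ p c₁ c₂)
    (s : Finset ℕ) (c : ℕ → ℝ) (μ : ℕ) :
    formV A f₀ p (fun t => ∑ ν ∈ s, c ν * φ ν t) (φ μ) = if μ ∈ s then c μ else 0 := by
  rw [W.formV_sum_left s c (fun i _ => E.continuous hm i) (E.continuous hm μ)]
  simp [E.orthonormal]

theorem formV_sum_self (E : IsEigensystem m A f₀ p φ ρ) (hm : 1 ≤ m)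
    (W : WeightBounds A f₀ p c₁ c₂) (s : Finset ℕ) (c : ℕ → ℝ) :
    formV A f₀ p (fun t => ∑ ν ∈ s, c ν * φ ν t) (fun t => ∑ ν ∈ s, c ν * φ ν t) =
      ∑ ν ∈ s, c ν ^ 2 := by
  have hc : Continuous fun t => ∑ ν ∈ s, c ν * φ ν t :=
    continuous_finsetSum _ fun i _ => (E.continuous hm i).const_mul _
  rw [W.formV_sum_left s c (fun i _ => E.continuous hm i) hc]
  refine Finset.sum_congr rfl fun ν hν => ?_
  rw [formV_comm, E.formV_sum hm W, if_pos hν, sq]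

theorem formU_sum_self (E : IsEigensystem m A f₀ p φ ρ) (hm : 1 ≤ m)
    (W : WeightBounds A f₀ p c₁ c₂) (s : Finset ℕ) (c : ℕ → ℝ) :
    formU m (fun t => ∑ ν ∈ s, c ν * φ ν t) (fun t => ∑ ν ∈ s, c ν * φ ν t) =
      ∑ ν ∈ s, ρ ν * c ν ^ 2 := by
  have hs := sum_mem_sobolev s c fun i _ => E.mem_sobolev i
  rw [formU_sum_right s c (fun i _ => E.mem_sobolev i) hs]
  refine Finset.sum_congr rfl fun ν hν => ?_
  rw [formU_eq_of_solvesODE hs (E.solves ν), E.formV_sum hm W, if_pos hν]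
  ring

/-- A dimension count in the manner of the min-max principle. In the span of φ_0, …, φ_N, of
dimension N + 1 > mK, some f ≠ 0 satisfies the mK vanishing conditions of the grid. The Poincaré
inequality then gives V(f, f) ≤ c₂ K^(-2m) U(f, f), whereas U(f, f) ≤ ρ_N V(f, f) on this span. -/
theorem pow_le_mul_rho (E : IsEigensystem m A f₀ p φ ρ) (hm : 1 ≤ m)
    (W : WeightBounds A f₀ p c₁ c₂) {K N : ℕ} (hK : 1 ≤ K) (hN : m * K ≤ N) :
    (K : ℝ) ^ (2 * m) ≤ c₂ * ρ N := by
  have hK0 : (0 : ℝ) < K := by exact_mod_cast hK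
  -- One row per condition, on the j-th derivative (j < m) at the grid point k/K; one column per
  -- eigenfunction. With more columns than rows the kernel is nontrivial.
  let M : Matrix (Fin K × Fin m) (Fin (N + 1)) ℝ := fun a ν => deriv01 a.2 (φ ν) (a.1 / K)
  have hker := LinearMap.ker_ne_bot_of_finrank_lt (f := M.mulVecLin) (by
    simp only [Module.finrank_fintype_fun_eq_card, Fintype.card_prod, Fintype.card_fin]
    rw [mul_comm K m]
    omega)
  obtain ⟨d, hd, hd0⟩ := Submodule.exists_mem_ne_zero_of_ne_bot hker
  set c : ℕ → ℝ := fun ν => if h : ν < N + 1 then d ⟨ν, h⟩ else 0 with hc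
  have hcd : ∀ ν : Fin (N + 1), c ν = d ν := fun ν => by simp only [hc, dif_pos ν.2, Fin.eta]
  set f : unitInterval → ℝ := fun t => ∑ ν ∈ Finset.range (N + 1), c ν * φ ν t with hf
  set g : ℕ → ℝ → ℝ := fun j x => ∑ ν ∈ Finset.range (N + 1), c ν * deriv01 j (φ ν) x with hg
  have hfS : f ∈ sobolev m := sum_mem_sobolev _ c fun i _ => E.mem_sobolev i
  have htow : IsTower m g :=
    IsTower.sum _ c fun i _ => isTower_of_mem_sobolev (E.mem_sobolev i)
  have hfg : ∀ x : unitInterval, f x = g 0 x := fun x =>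
    Finset.sum_congr rfl fun ν _ => by rw [← deriv01_zero_apply]
  have hgrid : ∀ k < K, ∀ j < m, g j (k / K) = 0 := fun k hk j hj => by
    have : ∑ ν, M (⟨k, hk⟩, ⟨j, hj⟩) ν * d ν = 0 :=
      congrFun (LinearMap.mem_ker.1 hd) (⟨k, hk⟩, ⟨j, hj⟩)
    simp only [hg]
    rw [Finset.sum_range, ← this]
    exact Finset.sum_congr rfl fun ν _ => by rw [hcd, mul_comm]
  have hpoin := htow.integral_sq_le_of_grid hm hK hgrid
  have hU : ∫ x in (0 : ℝ)..1, g m x ^ 2 = ∑ ν ∈ Finset.range (N + 1), ρ ν * c ν ^ 2 := by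
    rw [← E.formU_sum_self hm W]
    unfold formU
    refine intervalIntegral_congr_ae_Icc ?_
    filter_upwards [htow.deriv01_ae_eq hfg] with x hx
    rw [← hx, sq]
  have hV := W.formV_self_le (continuous_of_mem_sobolev hm hfS)
  rw [integral_unitInterval_eq (G := fun x => g 0 x ^ 2) fun x => by rw [hfg],
    E.formV_sum_self hm W] at hV
  have hUle : ∑ ν ∈ Finset.range (N + 1), ρ ν * c ν ^ 2 ≤
      ρ N * ∑ ν ∈ Finset.range (N + 1), c ν ^ 2 := by
    rw [Finset.mul_sum]
    refine Finset.sum_le_sum fun ν hν => mul_le_mul_of_nonneg_right (E.mono ?_) (sq_nonneg _)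
    rw [Finset.mem_range] at hν
    omega
  have hpos : 0 < ∑ ν ∈ Finset.range (N + 1), c ν ^ 2 := by
    rw [Finset.sum_range]
    obtain ⟨i, hi⟩ := Function.ne_iff.1 hd0
    refine Finset.sum_pos' (fun _ _ => sq_nonneg _) ⟨i, Finset.mem_univ _, ?_⟩
    rw [hcd]
    exact sq_pos_of_ne_zero hi
  rw [hU] at hpoin
  set S := ∑ ν ∈ Finset.range (N + 1), c ν ^ 2
  have hb : S ≤ c₂ * ((1 / (K : ℝ)) ^ (2 * m) * (ρ N * S)) :=
    hV.trans (mul_le_mul_of_nonneg_left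
      (hpoin.trans (mul_le_mul_of_nonneg_left hUle (by positivity))) W.c₂_pos.le)
  have hKp : (0 : ℝ) < (K : ℝ) ^ (2 * m) := by positivity
  rw [one_div, inv_pow] at hb
  have h2 : (K : ℝ) ^ (2 * m) * S ≤ c₂ * ρ N * S := by
    have := mul_le_mul_of_nonneg_left hb hKp.le
    calc (K : ℝ) ^ (2 * m) * S ≤ _ := this
      _ = c₂ * ρ N * S := by field_simp
  exact le_of_mul_le_mul_right h2 hpos

theorem rho_pos (E : IsEigensystem m A f₀ p φ ρ) (hm : 1 ≤ m)
    (W : WeightBounds A f₀ p c₁ c₂) {ν : ℕ} (hν : m ≤ ν) : 0 < ρ ν := by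
  have := E.pow_le_mul_rho hm W (K := 1) (N := ν) le_rfl (by omega)
  rw [Nat.cast_one, one_pow] at this
  exact pos_of_mul_pos_right (zero_lt_one.trans_le this) W.c₂_pos.le

theorem summable_rho_rpow (E : IsEigensystem m A f₀ p φ ρ) (hm : 1 ≤ m)
    (W : WeightBounds A f₀ p c₁ c₂) {β : ℝ} (hβ : 1 < β) :
    Summable fun k : ℕ => ρ (m + k) ^ (-(β / (2 * m))) := by
  have hm0 : (0 : ℝ) < m := by exact_mod_cast hm
  have hs : Summable fun k : ℕ => c₂ ^ (β / (2 * m)) * ((m : ℝ) ^ β * ((k + 1 : ℕ) : ℝ) ^ (-β)) := by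
    refine Summable.mul_left _ (Summable.mul_left _ ?_)
    exact (summable_nat_add_iff 1).2 (Real.summable_nat_rpow.2 (by linarith))
  refine Summable.of_nonneg_of_le (fun k => Real.rpow_nonneg (E.rho_nonneg _) _) (fun k => ?_) hs
  -- The finest admissible grid for N = m + k. The integer quotient satisfies mK ≥ k + 1, hence
  -- ρ_{m+k} ≥ ((k + 1)/m)^(2m)/c₂, and the power -β/(2m) turns this into a multiple of (k +
  -- 1)^(-β).
  set K := (m + k) / m with hKdef
  have hK : 1 ≤ K := (Nat.one_le_div_iff (by omega)).2 (by omega)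
  have h1 := E.pow_le_mul_rho hm W hK (Nat.mul_div_le (m + k) m)
  have hKlow : ((k + 1 : ℕ) : ℝ) / m ≤ K := by
    rw [div_le_iff₀ hm0]
    have := Nat.lt_mul_div_succ (m + k) (b := m) (by omega)
    have h2 : k + 1 ≤ K * m := by
      rw [hKdef, mul_comm]
      rw [mul_add, mul_one] at this
      omega
    exact_mod_cast h2
  have hρ := E.rho_pos hm W (ν := m + k) (by omega)
  have hq : 0 < β / (2 * m) := by positivity
  have hlow : (((k + 1 : ℕ) : ℝ) / m) ^ (2 * m) / c₂ ≤ ρ (m + k) := by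
    rw [div_le_iff₀ W.c₂_pos, mul_comm (ρ _)]
    exact (pow_le_pow_left₀ (by positivity) hKlow _).trans h1
  have hx : (0 : ℝ) < ((k + 1 : ℕ) : ℝ) := by positivity
  refine (Real.rpow_le_rpow_of_nonpos (by have := W.c₂_pos; positivity) hlow
    (by linarith)).trans_eq ?_
  rw [Real.div_rpow (by positivity) W.c₂_pos.le, ← Real.rpow_natCast, ← Real.rpow_mul (by positivity),
    Real.div_rpow hx.le hm0.le, Real.rpow_neg W.c₂_pos.le, div_inv_eq_mul, mul_comm]
  have he : ((2 * m : ℕ) : ℝ) * -(β / (2 * m)) = -β := by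
    push_cast
    field_simp
  rw [he, Real.rpow_neg hm0.le, div_inv_eq_mul, mul_comm (_ ^ (-β))]

theorem mem_span_of_mem_nullSpace (E : IsEigensystem m A f₀ p φ ρ) (hm : 1 ≤ m)
    {g : unitInterval → ℝ} (hg : g ∈ nullSpace m) :
    g ∈ Submodule.span ℝ (φ '' {ν | ρ ν = 0}) :=
  E.exhaustive g 0 (solvesODE_of_mem_nullSpace A f₀ p hm hg)

/-- The monomials of degree less than m lie in the span of the eigenfunctions of eigenvalue 0, so
there are at least m of these. All have index below m, since ρ_ν > 0 from m on; hence every such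
index occurs. -/
theorem rho_eq_zero (E : IsEigensystem m A f₀ p φ ρ) (hm : 1 ≤ m)
    (W : WeightBounds A f₀ p c₁ c₂) {ν : ℕ} (hν : ν < m) : ρ ν = 0 := by
  classical
  set Z : Finset ℕ := (Finset.range m).filter fun ν => ρ ν = 0 with hZ
  have hZeq : {ν | ρ ν = 0} = (Z : Set ℕ) := by
    ext ν
    simp only [hZ, mem_ofPred_eq, Finset.coe_filter, Finset.mem_range]
    refine ⟨fun h => ⟨?_, h⟩, fun h => h.2⟩
    by_contra hlt
    exact (E.rho_pos hm W (not_lt.1 hlt)).ne' h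
  set S := Submodule.span ℝ ((Z.image φ : Finset (unitInterval → ℝ)) : Set (unitInterval → ℝ))
  have hmem : ∀ k : Fin m, (fun t : unitInterval => (t : ℝ) ^ (k : ℕ)) ∈ S := fun k => by
    have := E.mem_span_of_mem_nullSpace hm (pow_mem_nullSpace k.2)
    rwa [hZeq, ← Finset.coe_image] at this
  have hli : LinearIndependent ℝ
      (fun k : Fin m => (⟨fun t : unitInterval => (t : ℝ) ^ (k : ℕ), hmem k⟩ : S)) :=
    LinearIndependent.of_comp S.subtype (linearIndependent_pow_unitInterval m)
  have h1 := hli.fintype_card_le_finrank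
  have h2 := finrank_span_finset_le_card (R := ℝ) (Z.image φ)
  have h3 : Z.card = (Finset.range m).card := by
    refine le_antisymm (Finset.card_filter_le _ _) ?_
    rw [Fintype.card_fin] at h1
    rw [Finset.card_range]
    exact h1.trans (h2.trans Finset.card_image_le)
  exact Finset.card_filter_eq_iff.1 h3 ν (Finset.mem_range.2 hν)

theorem eq_sum_of_mem_nullSpace (E : IsEigensystem m A f₀ p φ ρ) (hm : 1 ≤ m)
    (W : WeightBounds A f₀ p c₁ c₂) {g : unitInterval → ℝ} (hg : g ∈ nullSpace m) :
    g = fun t => ∑ ν ∈ Finset.range m, formV A f₀ p g (φ ν) * φ ν t := by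
  have h := E.mem_span_of_mem_nullSpace hm hg
  have hZeq : {ν | ρ ν = 0} = ((Finset.range m : Finset ℕ) : Set ℕ) := by
    ext ν
    simp only [mem_ofPred_eq, Finset.coe_range, mem_Iio]
    refine ⟨fun h => ?_, E.rho_eq_zero hm W⟩
    by_contra hlt
    exact (E.rho_pos hm W (not_lt.1 hlt)).ne' h
  rw [hZeq, Submodule.mem_span_image_finset_iff_exists_fun'] at h
  obtain ⟨c, hc⟩ := h
  have hc' : g = fun t => ∑ ν ∈ Finset.range m, c ν * φ ν t := by
    rw [← hc]
    ext t
    simp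
  have hcoef : ∀ ν ∈ Finset.range m, formV A f₀ p g (φ ν) = c ν := fun ν hν => by
    rw [hc', E.formV_sum hm W, if_pos hν]
  rw [hc']
  ext t
  refine Finset.sum_congr rfl fun ν hν => ?_
  rw [← hcoef ν hν, ← hc']

theorem sum_mem_nullSpace (E : IsEigensystem m A f₀ p φ ρ) (hm : 1 ≤ m)
    (W : WeightBounds A f₀ p c₁ c₂) (c : ℕ → ℝ) :
    (fun t => ∑ ν ∈ Finset.range m, c ν * φ ν t) ∈ nullSpace m := by
  refine ⟨sum_mem_sobolev _ c fun i _ => E.mem_sobolev i, ?_⟩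
  rw [E.formU_sum_self hm W]
  exact Finset.sum_eq_zero fun ν hν => by
    rw [E.rho_eq_zero hm W (Finset.mem_range.1 hν), zero_mul]

/-- Parseval's identity in the null space. The projection is obtained by choice, so only its
defining orthogonality is used; this already fixes its coefficients V(q, φ_ν) = V(f, φ_ν) for ν < m.
-/
theorem formV_proj (E : IsEigensystem m A f₀ p φ ρ) (hm : 1 ≤ m)
    (W : WeightBounds A f₀ p c₁ c₂) {f : unitInterval → ℝ} (hf : Continuous f) :
    formV A f₀ p (proj m A f₀ p f) (proj m A f₀ p f) =
      ∑ ν ∈ Finset.range m, formV A f₀ p f (φ ν) ^ 2 := by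
  have hnull : ∀ ν < m, φ ν ∈ nullSpace m := fun ν hν => by
    refine ⟨E.mem_sobolev ν, ?_⟩
    rw [E.formU_apply, if_pos rfl, E.rho_eq_zero hm W hν]
  have hcont : ∀ q ∈ nullSpace m, Continuous q := fun q hq => continuous_of_mem_sobolev hm hq.1
  have hex : ∃ q ∈ nullSpace m, ∀ r ∈ nullSpace m, formV A f₀ p (f - q) r = 0 := by
    have hq := E.sum_mem_nullSpace hm W fun ν => formV A f₀ p f (φ ν)
    refine ⟨_, hq, fun r hr => ?_⟩
    rw [E.eq_sum_of_mem_nullSpace hm W hr, formV_comm,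
      W.formV_sum_left _ _ (fun i _ => E.continuous hm i) (hf.sub (hcont _ hq))]
    refine Finset.sum_eq_zero fun ν hν => ?_
    rw [formV_comm _ _ _ (φ ν), W.formV_sub_left hf (hcont _ hq) (E.continuous hm ν),
      E.formV_sum hm W, if_pos hν, sub_self, mul_zero]
  have hproj : proj m A f₀ p f = hex.choose := by
    unfold proj
    rw [dif_pos hex]
  obtain ⟨hq, horth⟩ := hex.choose_spec
  rw [← hproj] at hq horth
  set q := proj m A f₀ p f
  have hcoef : ∀ ν ∈ Finset.range m, formV A f₀ p q (φ ν) = formV A f₀ p f (φ ν) := fun ν hν => by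
    have := horth (φ ν) (hnull ν (Finset.mem_range.1 hν))
    rw [W.formV_sub_left hf (hcont q hq) (E.continuous hm ν)] at this
    linarith
  have hexp := E.eq_sum_of_mem_nullSpace hm W hq
  rw [Finset.sum_congr rfl fun ν hν => by rw [← hcoef ν hν], ← E.formV_sum_self hm W, ← hexp]

/-- Taylor expansion with integral remainder, the polynomial part being expressed by the
eigenfunctions of the eigenvalue `0`. -/
theorem eq_iterInt_add (E : IsEigensystem m A f₀ p φ ρ) (hm : 1 ≤ m)
    (W : WeightBounds A f₀ p c₁ c₂) {f R : unitInterval → ℝ} (hf : f ∈ sobolev m)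
    (hR : R = fun t : unitInterval => iterInt m (deriv01 m f) t) (t : unitInterval) :
    f t = R t +
      ∑ ν ∈ Finset.range m, (formV A f₀ p f (φ ν) - formV A f₀ p R (φ ν)) * φ ν t := by
  have ht := isTower_iterInt m hf.2
  have hR0 : ∀ x : unitInterval, R x = iterInt (m - 0) (deriv01 m f) x := fun x => by rw [hR]; rfl
  have hRS := ht.mem_sobolev hR0
  have hnull : f - R ∈ nullSpace m := by
    refine mem_nullSpace_iff.2 ⟨(sub_mem_sobolev hf hRS).1, ?_⟩
    filter_upwards [(sub_mem_sobolev hf hRS).2, ht.deriv01_ae_eq hR0] with x hx hx2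
    rw [hx, hx2, Nat.sub_self]
    simp [iterInt]
  have := congrFun (E.eq_sum_of_mem_nullSpace hm W hnull) t
  simp only [W.formV_sub_left (continuous_of_mem_sobolev hm hf) (continuous_of_mem_sobolev hm hRS)
    (E.continuous hm _)] at this
  rw [← this, Pi.sub_apply]
  ring

end IsEigensystem

/-! ### Pointwise bounds and convergence of eigenfunction series -/

theorem IsTower.sq_le_integral_sq {m : ℕ} (hm : 1 ≤ m) {g : ℕ → ℝ → ℝ} (hg : IsTower m g)
    (h0 : ∀ j < m, g j 0 = 0) {x : ℝ} (hx : x ∈ Icc (0 : ℝ) 1) :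
    g 0 x ^ 2 ≤ ∫ t in (0 : ℝ)..1, g m t ^ 2 := by
  have h1 := hg.abs_le_integral (a := 0) (b := 1) (by simp) (by simp) zero_le_one h0 (m - 1)
    (by omega) x hx
  rw [Nat.sub_self, sub_zero, one_pow, one_mul] at h1
  have h2 := sq_integral_abs_le hg.2 (a := 0) (b := 1) (by simp) (by simp) zero_le_one
  rw [sub_zero, one_mul] at h2
  rw [← sq_abs]
  exact (pow_le_pow_left₀ (abs_nonneg _) h1 2).trans h2

theorem iterInt_apply_zero {k : ℕ} (hk : k ≠ 0) (h : ℝ → ℝ) : iterInt k h 0 = 0 := by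
  obtain ⟨k, rfl⟩ := Nat.exists_eq_succ_of_ne_zero hk
  simp [iterInt]

theorem sq_iterInt_le {m : ℕ} (hm : 1 ≤ m) {h : ℝ → ℝ}
    (hh : MemLp h 2 (volume.restrict (Icc (0 : ℝ) 1))) {x : ℝ} (hx : x ∈ Icc (0 : ℝ) 1) :
    iterInt m h x ^ 2 ≤ ∫ t in (0 : ℝ)..1, h t ^ 2 := by
  have := (isTower_iterInt m hh).sq_le_integral_sq hm
    (fun j hj => iterInt_apply_zero (by omega) h) hx
  simpa [iterInt] using this

theorem sq_iterInt_sub_le {m : ℕ} (hm : 1 ≤ m) {h h' : ℝ → ℝ}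
    (hh : MemLp h 2 (volume.restrict (Icc (0 : ℝ) 1)))
    (hh' : MemLp h' 2 (volume.restrict (Icc (0 : ℝ) 1))) {x : ℝ} (hx : x ∈ Icc (0 : ℝ) 1) :
    (iterInt m h x - iterInt m h' x) ^ 2 ≤ ∫ t in (0 : ℝ)..1, (h t - h' t) ^ 2 := by
  have := ((isTower_iterInt m hh).add ((isTower_iterInt m hh').const_mul (-1))).sq_le_integral_sq hm
    (fun j hj => by
      rw [iterInt_apply_zero (by omega), iterInt_apply_zero (by omega)]
      ring) hx
  simpa [iterInt, ← sub_eq_add_neg] using this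

theorem exists_abs_le_of_continuous {f : unitInterval → ℝ} (hf : Continuous f) :
    ∃ B, 0 ≤ B ∧ ∀ x, |f x| ≤ B := by
  obtain ⟨B, hB⟩ := isCompact_univ.exists_bound_of_continuousOn (hf.continuousOn (s := univ))
  exact ⟨B, (norm_nonneg _).trans (hB 0 (mem_univ _)), fun x => hB x (mem_univ _)⟩

/-- The sum `∑_ν c_ν φ_ν`. -/
noncomputable def eigenSeries (φ : ℕ → unitInterval → ℝ) (c : ℕ → ℝ) : unitInterval → ℝ :=
  fun t => ∑' ν, c ν * φ ν t

/-- The coefficients of `J` with respect to the eigenfunctions. -/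
noncomputable def penaltyCoeff (m : ℕ) (ρ : ℕ → ℝ) (ν : ℕ) : ℝ := if ν < m then 1 else ρ ν

namespace IsEigensystem

variable {m : ℕ} {A : ℝ → ℝ} {f₀ p : unitInterval → ℝ} {φ : ℕ → unitInterval → ℝ} {ρ : ℕ → ℝ}
  {c₁ c₂ : ℝ}

/-- A Sobolev embedding in coordinates, uniform in the finite set. In the Taylor decomposition the
remainder is controlled by U(f, f), and the polynomial part by finitely many coefficients V(f, φ_ν)
and V(R, φ_ν). -/
theorem exists_sq_sum_le (E : IsEigensystem m A f₀ p φ ρ) (hm : 1 ≤ m)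
    (W : WeightBounds A f₀ p c₁ c₂) :
    ∃ C, 0 ≤ C ∧ ∀ (s : Finset ℕ) (c : ℕ → ℝ) (t : unitInterval),
      (∑ ν ∈ s, c ν * φ ν t) ^ 2 ≤ C * ∑ ν ∈ s, (1 + ρ ν) * c ν ^ 2 := by
  choose B hB0 hB using fun ν => exists_abs_le_of_continuous (E.continuous hm ν)
  -- The 1 accounts for the remainder R; each ν < m adds a coefficient of size at most (1 + c₂
  -- B_ν)√T times the supremum bound B_ν of φ_ν.
  set D : ℝ := 1 + ∑ ν ∈ Finset.range m, (1 + c₂ * B ν) * B ν with hD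
  refine ⟨D ^ 2, sq_nonneg _, fun s c t => ?_⟩
  set T := ∑ ν ∈ s, (1 + ρ ν) * c ν ^ 2 with hT
  have hterm : ∀ ν ∈ s, 0 ≤ (1 + ρ ν) * c ν ^ 2 := fun ν _ =>
    mul_nonneg (by linarith [E.rho_nonneg ν]) (sq_nonneg _)
  have hT0 : 0 ≤ T := Finset.sum_nonneg hterm
  set f : unitInterval → ℝ := fun t => ∑ ν ∈ s, c ν * φ ν t with hf
  have hfS : f ∈ sobolev m := sum_mem_sobolev s c fun i _ => E.mem_sobolev i
  set R : unitInterval → ℝ := fun t => iterInt m (deriv01 m f) t with hR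
  have hU : ∫ x in (0 : ℝ)..1, deriv01 m f x ^ 2 ≤ T := by
    have : ∫ x in (0 : ℝ)..1, deriv01 m f x ^ 2 = formU m f f := by
      unfold formU
      simp only [sq]
    rw [this, E.formU_sum_self hm W]
    exact Finset.sum_le_sum fun ν _ =>
      mul_le_mul_of_nonneg_right (by linarith) (sq_nonneg _)
  have hRb : ∀ x, |R x| ≤ √T := fun x =>
    Real.abs_le_sqrt ((sq_iterInt_le hm hfS.2 x.2).trans hU)
  have hVf : ∀ ν, |formV A f₀ p f (φ ν)| ≤ √T := fun ν => by
    rw [E.formV_sum hm W]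
    split_ifs with h
    · refine Real.abs_le_sqrt ?_
      refine le_trans ?_ (Finset.single_le_sum hterm h)
      nlinarith [E.rho_nonneg ν, sq_nonneg (c ν), mul_nonneg (E.rho_nonneg ν) (sq_nonneg (c ν))]
    · simp
  have hle : |f t| ≤ D * √T := by
    rw [E.eq_iterInt_add hm W hfS hR t]
    refine (abs_add_le _ _).trans ?_
    rw [hD, add_mul, one_mul]
    refine add_le_add (hRb t) ((Finset.abs_sum_le_sum_abs _ _).trans ?_)
    rw [Finset.sum_mul]
    refine Finset.sum_le_sum fun ν _ => ?_
    rw [abs_mul]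
    have h1 := W.abs_formV_le hRb (hB ν)
    have h2 : |formV A f₀ p f (φ ν) - formV A f₀ p R (φ ν)| ≤ √T + c₂ * (√T * B ν) :=
      (abs_sub _ _).trans (add_le_add (hVf ν) h1)
    refine (mul_le_mul h2 (hB ν t) (abs_nonneg _) ?_).trans_eq (by ring)
    exact add_nonneg (Real.sqrt_nonneg _) (mul_nonneg W.c₂_pos.le
      (mul_nonneg (Real.sqrt_nonneg _) (hB0 ν)))
  calc (f t) ^ 2 = |f t| ^ 2 := (sq_abs _).symm
    _ ≤ (D * √T) ^ 2 := pow_le_pow_left₀ (abs_nonneg _) hle 2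
    _ = D ^ 2 * T := by rw [mul_pow, Real.sq_sqrt hT0]

theorem summable_sq_div (E : IsEigensystem m A f₀ p φ ρ) (hm : 1 ≤ m)
    (W : WeightBounds A f₀ p c₁ c₂) (t : unitInterval) :
    Summable fun ν => φ ν t ^ 2 / (1 + ρ ν) := by
  obtain ⟨C, hC0, hC⟩ := E.exists_sq_sum_le hm W
  have hpos : ∀ ν, 0 < 1 + ρ ν := fun ν => by linarith [E.rho_nonneg ν]
  refine summable_of_sum_le (c := C) (fun ν => div_nonneg (sq_nonneg _) (hpos ν).le) fun s => ?_
  -- Duality: for these coefficients both sums equal S = ∑ φ_ν(t)²/(1 + ρ_ν), so the bound reads S²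
  -- ≤ C S, whence S ≤ C.
  have h := hC s (fun ν => φ ν t / (1 + ρ ν)) t
  have h1 : ∑ ν ∈ s, φ ν t / (1 + ρ ν) * φ ν t = ∑ ν ∈ s, φ ν t ^ 2 / (1 + ρ ν) :=
    Finset.sum_congr rfl fun ν _ => by ring
  have h2 : ∑ ν ∈ s, (1 + ρ ν) * (φ ν t / (1 + ρ ν)) ^ 2 = ∑ ν ∈ s, φ ν t ^ 2 / (1 + ρ ν) :=
    Finset.sum_congr rfl fun ν _ => by
      have := (hpos ν).ne'
      field_simp
  rw [h1, h2] at h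
  by_contra! hlt
  nlinarith

theorem summable_eigenSeries (E : IsEigensystem m A f₀ p φ ρ) (hm : 1 ≤ m)
    (W : WeightBounds A f₀ p c₁ c₂) {c : ℕ → ℝ} (hc : Summable fun ν => (1 + ρ ν) * c ν ^ 2)
    (t : unitInterval) : Summable fun ν => c ν * φ ν t := by
  refine Summable.of_norm_bounded (hc.add (E.summable_sq_div hm W t)) fun ν => ?_
  have hpos : 0 < 1 + ρ ν := by linarith [E.rho_nonneg ν]
  rw [Real.norm_eq_abs]
  have h1 : |c ν * φ ν t| = |(√(1 + ρ ν) * c ν) * (φ ν t / √(1 + ρ ν))| := by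
    congr 1
    have := (Real.sqrt_pos.2 hpos).ne'
    field_simp
  have h2 : (1 + ρ ν) * c ν ^ 2 = (√(1 + ρ ν) * c ν) ^ 2 := by
    rw [mul_pow, Real.sq_sqrt hpos.le]
  have h3 : φ ν t ^ 2 / (1 + ρ ν) = (φ ν t / √(1 + ρ ν)) ^ 2 := by
    rw [div_pow, Real.sq_sqrt hpos.le]
  rw [h1, h2, h3, abs_mul]
  nlinarith [sq_nonneg (|√(1 + ρ ν) * c ν| - |φ ν t / √(1 + ρ ν)|),
    sq_abs (√(1 + ρ ν) * c ν), sq_abs (φ ν t / √(1 + ρ ν)), abs_nonneg (√(1 + ρ ν) * c ν),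
    abs_nonneg (φ ν t / √(1 + ρ ν))]

theorem exists_limit_deriv01 (E : IsEigensystem m A f₀ p φ ρ) {c : ℕ → ℝ}
    (hc : Summable fun ν => ρ ν * c ν ^ 2) :
    ∃ H : ℝ → ℝ, MemLp H 2 (volume.restrict (Icc (0 : ℝ) 1)) ∧
      Tendsto (fun N => ∫ x in (0 : ℝ)..1,
        ((∑ ν ∈ Finset.range N, c ν * deriv01 m (φ ν) x) - H x) ^ 2) atTop (𝓝 0) ∧
      HasSum (fun ν => ρ ν * c ν ^ 2) (∫ x in (0 : ℝ)..1, H x ^ 2) := by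
  set μ : Measure ℝ := volume.restrict (Icc (0 : ℝ) 1) with hμ
  let e : ℕ → Lp ℝ 2 μ := fun ν => (E.mem_sobolev ν).2.toLp _
  have hnorm : ∀ u : Lp ℝ 2 μ, ∫ x in (0 : ℝ)..1, u x ^ 2 = ‖u‖ ^ 2 := fun u => by
    rw [← real_inner_self_eq_norm_sq, L2.inner_def, integral_of_le zero_le_one,
      ← integral_Icc_eq_integral_Ioc]
    refine MeasureTheory.integral_congr_ae (Eventually.of_forall fun x => ?_)
    simp [sq]
  have hinner : ∀ i j, inner ℝ (e i) (e j) = if i = j then ρ j else 0 := fun i j => by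
    rw [← E.formU_apply i j, L2.inner_def]
    unfold formU
    rw [integral_of_le zero_le_one, ← integral_Icc_eq_integral_Ioc]
    refine MeasureTheory.integral_congr_ae ?_
    filter_upwards [(E.mem_sobolev i).2.coeFn_toLp, (E.mem_sobolev j).2.coeFn_toLp] with x hi hj
    simp [e, hi, hj, mul_comm]
  have hnorme : ∀ i, ‖e i‖ ^ 2 = ρ i := fun i => by
    rw [← real_inner_self_eq_norm_sq, hinner, if_pos rfl]
  -- The lines spanned by the `e i` replace normalized vectors, because `e i` has squared norm ρ_i,
  -- which may be 0.
  have horth : OrthogonalFamily ℝ (fun i => (ℝ ∙ e i : Submodule ℝ (Lp ℝ 2 μ)))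
      (fun i => (ℝ ∙ e i : Submodule ℝ (Lp ℝ 2 μ)).subtypeₗᵢ) := by
    intro i j hij u v
    obtain ⟨a, ha⟩ := Submodule.mem_span_singleton.1 u.2
    obtain ⟨b, hb⟩ := Submodule.mem_span_singleton.1 v.2
    change inner ℝ (u : Lp ℝ 2 μ) (v : Lp ℝ 2 μ) = 0
    rw [← ha, ← hb, real_inner_smul_left, real_inner_smul_right, hinner, if_neg hij]
    simp
  have hsum : Summable fun i => c i • e i := by
    have := (horth.summable_iff_norm_sq_summable fun i =>
      (⟨c i • e i, Submodule.smul_mem _ _ (Submodule.mem_span_singleton_self _)⟩ : (ℝ ∙ e i : Submodule ℝ (Lp ℝ 2 μ)))).2 (by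
        refine hc.congr fun i => ?_
        simp only [Submodule.coe_norm]
        rw [norm_smul, mul_pow, hnorme, Real.norm_eq_abs, sq_abs, mul_comm])
    exact this
  set x := ∑' i, c i • e i with hx
  have htend : Tendsto (fun N => ∑ i ∈ Finset.range N, c i • e i) atTop (𝓝 x) :=
    hsum.hasSum.tendsto_sum_nat
  have hcoe : ∀ N, (∑ i ∈ Finset.range N, c i • e i : Lp ℝ 2 μ) =ᵐ[μ]
      fun y => ∑ ν ∈ Finset.range N, c ν * deriv01 m (φ ν) y := fun N => by
    refine (Lp.coeFn_finsetSum _ _).trans ?_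
    have : ∀ᵐ y ∂μ, ∀ i, (c i • e i : Lp ℝ 2 μ) y = c i * deriv01 m (φ i) y := by
      rw [ae_all_iff]
      intro i
      filter_upwards [Lp.coeFn_smul (c i) (e i), (E.mem_sobolev i).2.coeFn_toLp] with y h1 h2
      rw [h1, Pi.smul_apply, h2, smul_eq_mul]
    filter_upwards [this] with y hy
    simp only [Finset.sum_apply, hy]
  refine ⟨x, Lp.memLp x, ?_, ?_⟩
  · have h1 : Tendsto (fun N => ‖(∑ i ∈ Finset.range N, c i • e i) - x‖ ^ 2) atTop (𝓝 0) := by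
      have := (tendsto_iff_norm_sub_tendsto_zero.1 htend).pow 2
      simpa using this
    refine h1.congr fun N => ?_
    rw [← hnorm]
    refine intervalIntegral_congr_ae_Icc ?_
    filter_upwards [Lp.coeFn_sub (∑ i ∈ Finset.range N, c i • e i) x, hcoe N] with y h1 h2
    rw [h1, Pi.sub_apply, h2]
  · refine hc.hasSum_iff_tendsto_nat.2 ?_
    rw [hnorm]
    refine (htend.norm.pow 2).congr fun N => ?_
    have := horth.norm_sum (fun i => (⟨c i • e i, Submodule.smul_mem _ _
      (Submodule.mem_span_singleton_self _)⟩ : (ℝ ∙ e i : Submodule ℝ (Lp ℝ 2 μ)))) (Finset.range N)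
    refine this.trans ?_
    simp only [Submodule.coe_norm]
    refine Finset.sum_congr rfl fun i _ => ?_
    rw [norm_smul, mul_pow, hnorme, Real.norm_eq_abs, sq_abs, mul_comm]

/-- The m-th derivatives of the partial sums converge in L² to some H, so their m-fold integrals
converge uniformly. Passing to the limit in the Taylor decomposition shows the series to be an
m-fold integral of H plus an element of the null space, hence a member of S^m with m-th derivative
H. -/
theorem eigenSeries_spec (E : IsEigensystem m A f₀ p φ ρ) (hm : 1 ≤ m)
    (W : WeightBounds A f₀ p c₁ c₂) {c : ℕ → ℝ} (hc : Summable fun ν => (1 + ρ ν) * c ν ^ 2) :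
    eigenSeries φ c ∈ sobolev m ∧
      HasSum (fun ν => ρ ν * c ν ^ 2) (formU m (eigenSeries φ c) (eigenSeries φ c)) := by
  have hcρ : Summable fun ν => ρ ν * c ν ^ 2 :=
    Summable.of_nonneg_of_le (fun ν => mul_nonneg (E.rho_nonneg ν) (sq_nonneg _))
      (fun ν => mul_le_mul_of_nonneg_right (by linarith) (sq_nonneg _)) hc
  obtain ⟨H, hH, hlim, hsum⟩ := E.exists_limit_deriv01 hcρ
  set f : ℕ → unitInterval → ℝ := fun N t => ∑ ν ∈ Finset.range N, c ν * φ ν t with hf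
  have hfS : ∀ N, f N ∈ sobolev m := fun N => sum_mem_sobolev _ c fun i _ => E.mem_sobolev i
  set R : unitInterval → ℝ := fun t => iterInt m H t with hR
  set RN : ℕ → unitInterval → ℝ := fun N t => iterInt m (deriv01 m (f N)) t with hRN
  set δ : ℕ → ℝ := fun N => √(∫ x in (0 : ℝ)..1, (deriv01 m (f N) x - H x) ^ 2) with hδ
  have hδ0 : Tendsto δ atTop (𝓝 0) := by
    have := (Real.continuous_sqrt.tendsto 0).comp hlim
    rw [Real.sqrt_zero] at this
    refine this.congr fun N => ?_
    simp only [hδ, Function.comp_apply]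
    congr 1
    refine intervalIntegral_congr_ae_Icc ?_
    filter_upwards [deriv01_sum_ae (Finset.range N) c fun i _ => E.mem_sobolev i] with x hx
    rw [← hx]
  have hclose : ∀ N x, |(RN N - R) x| ≤ δ N := fun N x =>
    Real.abs_le_sqrt (sq_iterInt_sub_le hm (hfS N).2 hH x.2)
  have hRS : R ∈ sobolev m := (isTower_iterInt m hH).mem_sobolev fun x => rfl
  have hRd : deriv01 m R =ᵐ[volume.restrict (Icc (0 : ℝ) 1)] H := by
    have := (isTower_iterInt m hH).deriv01_ae_eq (f := R) fun x => rfl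
    simpa [iterInt] using this
  have hRNS : ∀ N, RN N ∈ sobolev m := fun N =>
    (isTower_iterInt m (hfS N).2).mem_sobolev fun x => rfl
  have hRlim : ∀ x, Tendsto (fun N => RN N x) atTop (𝓝 (R x)) := fun x => by
    rw [tendsto_iff_norm_sub_tendsto_zero]
    exact squeeze_zero (fun N => norm_nonneg _) (fun N => hclose N x) hδ0
  have hVlim : ∀ ν, Tendsto (fun N => formV A f₀ p (RN N) (φ ν)) atTop
      (𝓝 (formV A f₀ p R (φ ν))) := fun ν => by
    obtain ⟨B, hB0, hB⟩ := exists_abs_le_of_continuous (E.continuous hm ν)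
    rw [tendsto_iff_norm_sub_tendsto_zero]
    refine squeeze_zero (fun N => norm_nonneg _) (fun N => ?_)
      (by simpa using (hδ0.mul_const B).const_mul c₂)
    rw [← W.formV_sub_left (continuous_of_mem_sobolev hm (hRNS N))
      (continuous_of_mem_sobolev hm hRS) (E.continuous hm ν)]
    exact W.abs_formV_le (hclose N) hB
  have hform : ∀ t, eigenSeries φ c t = R t +
      ∑ ν ∈ Finset.range m, (c ν - formV A f₀ p R (φ ν)) * φ ν t := fun t => by
    refine tendsto_nhds_unique (E.summable_eigenSeries hm W hc t).hasSum.tendsto_sum_nat ?_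
    have hl := (hRlim t).add (tendsto_finsetSum (Finset.range m) fun ν _ =>
      ((tendsto_const_nhds (x := c ν)).sub (hVlim ν)).mul_const (φ ν t))
    refine hl.congr' ?_
    -- Once N ≥ m, the first m coefficients of the partial sum no longer change.
    filter_upwards [eventually_ge_atTop m] with N hN
    have := E.eq_iterInt_add hm W (hfS N) (R := RN N) rfl t
    simp only [hf] at this
    rw [this]
    congr 1
    refine Finset.sum_congr rfl fun ν hν => ?_
    rw [E.formV_sum hm W, if_pos (Finset.range_mono hN hν)]
  have hpS := E.sum_mem_nullSpace hm W fun ν => c ν - formV A f₀ p R (φ ν)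
  set q : unitInterval → ℝ :=
    fun t => ∑ ν ∈ Finset.range m, (c ν - formV A f₀ p R (φ ν)) * φ ν t with hq
  have htow := (isTower_of_mem_sobolev hRS).add (isTower_of_mem_sobolev hpS.1)
  have h0 : ∀ x : unitInterval, eigenSeries φ c x = deriv01 0 R x + deriv01 0 q x := fun x => by
    rw [← deriv01_zero_apply, ← deriv01_zero_apply, hform]
  refine ⟨htow.mem_sobolev h0, ?_⟩
  have hU : formU m (eigenSeries φ c) (eigenSeries φ c) = ∫ x in (0 : ℝ)..1, H x ^ 2 := by
    refine intervalIntegral_congr_ae_Icc ?_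
    filter_upwards [htow.deriv01_ae_eq h0, hRd, deriv01_ae_zero_of_mem_nullSpace hpS] with x h1 h2 h3
    rw [h1, h2, h3]
    ring
  rw [hU]
  exact hsum

/-- Dominated convergence, the partial sums being uniformly bounded by `exists_sq_sum_le`. This
makes the coefficients functionals of the sum, so that densities on sequences can be read as
densities on functions. -/
theorem formV_eigenSeries (E : IsEigensystem m A f₀ p φ ρ) (hm : 1 ≤ m)
    (W : WeightBounds A f₀ p c₁ c₂) {c : ℕ → ℝ} (hc : Summable fun ν => (1 + ρ ν) * c ν ^ 2)
    (μ : ℕ) : formV A f₀ p (eigenSeries φ c) (φ μ) = c μ := by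
  obtain ⟨C, hC0, hC⟩ := E.exists_sq_sum_le hm W
  obtain ⟨B, hB0, hB⟩ := exists_abs_le_of_continuous (E.continuous hm μ)
  set T := ∑' ν, (1 + ρ ν) * c ν ^ 2 with hT
  have hbound : ∀ N t, |∑ ν ∈ Finset.range N, c ν * φ ν t| ≤ √(C * T) := fun N t => by
    refine Real.abs_le_sqrt ((hC _ c t).trans (mul_le_mul_of_nonneg_left ?_ hC0))
    exact hc.sum_le_tsum _ fun ν _ => mul_nonneg (by linarith [E.rho_nonneg ν]) (sq_nonneg _)
  have hcont : ∀ N, Continuous fun t => ∑ ν ∈ Finset.range N, c ν * φ ν t := fun N =>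
    continuous_finsetSum _ fun i _ => (E.continuous hm i).const_mul _
  have hlim : Tendsto (fun N => formV A f₀ p (fun t => ∑ ν ∈ Finset.range N, c ν * φ ν t) (φ μ))
      atTop (𝓝 (formV A f₀ p (eigenSeries φ c) (φ μ))) := by
    simp only [formV_eq]
    refine tendsto_integral_of_dominated_convergence (fun _ => c₂ * (√(C * T) * B))
      (fun N => (W.integrable (F := fun t => (∑ ν ∈ Finset.range N, c ν * φ ν t) * φ μ t)
        ((hcont N).mul (E.continuous hm μ))).aestronglyMeasurable)
      (integrable_const _) (fun N => Eventually.of_forall fun t => ?_)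
      (Eventually.of_forall fun t => ?_)
    · rw [norm_mul, norm_mul (∑ ν ∈ Finset.range N, c ν * φ ν t)]
      exact mul_le_mul (W.norm_le t) (mul_le_mul (hbound N t) (hB t) (abs_nonneg _)
        (Real.sqrt_nonneg _)) (by positivity) W.c₂_pos.le
    · exact ((E.summable_eigenSeries hm W hc t).hasSum.tendsto_sum_nat.mul_const _).const_mul _
  refine tendsto_nhds_unique hlim (tendsto_const_nhds.congr' ?_)
  filter_upwards [eventually_gt_atTop μ] with N hN
  rw [E.formV_sum hm W, if_pos (Finset.mem_range.2 hN)]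

/-- The two parts of J are complementary: V(f†, f†) sees only ν < m, where ρ_ν = 0 removes the
contribution of U. -/
theorem hasSum_formJ (E : IsEigensystem m A f₀ p φ ρ) (hm : 1 ≤ m)
    (W : WeightBounds A f₀ p c₁ c₂) {c : ℕ → ℝ} (hc : Summable fun ν => (1 + ρ ν) * c ν ^ 2) :
    HasSum (fun ν => penaltyCoeff m ρ ν * c ν ^ 2)
      (formJ m A f₀ p (eigenSeries φ c) (eigenSeries φ c)) := by
  obtain ⟨hS, hU⟩ := E.eigenSeries_spec hm W hc
  have h1 : HasSum (fun ν => if ν < m then c ν ^ 2 else 0) (∑ ν ∈ Finset.range m, c ν ^ 2) := by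
    have := hasSum_sum_of_ne_finset_zero (L := .unconditional ℕ) (f := fun ν => if ν < m then c ν ^ 2 else 0)
      (s := Finset.range m) fun ν hν => if_neg (by simpa using hν)
    rwa [Finset.sum_congr rfl fun ν hν => if_pos (Finset.mem_range.1 hν)] at this
  unfold formJ
  rw [E.formV_proj hm W (continuous_of_mem_sobolev hm hS)]
  simp only [E.formV_eigenSeries hm W hc]
  convert! h1.add hU using 1
  ext ν
  unfold penaltyCoeff
  split_ifs with h
  · rw [E.rho_eq_zero hm W h]
    ring
  · simp

end IsEigensystem

/-! ### Gaussian product measures on sequences -/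

/-- Changing the variance of a centred Gaussian law amounts to an exponential tilt. -/
theorem gaussianReal_eq_withDensity {t s : ℝ≥0} (ht : 0 < t) {κ : ℝ} (hκ : 0 ≤ κ)
    (hs : (s : ℝ) = t / (1 + κ * t)) :
    gaussianReal 0 s = (gaussianReal 0 t).withDensity fun x =>
      ENNReal.ofReal (√(1 + κ * t) * Real.exp (-(κ / 2) * x ^ 2)) := by
  have ht' : (0 : ℝ) < t := by exact_mod_cast ht
  have hk : 0 < 1 + κ * t := by positivity
  have hs' : (0 : ℝ) < s := by rw [hs]; positivity
  have hs0 : s ≠ 0 := fun h => by simp [h] at hs'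
  rw [gaussianReal_of_var_ne_zero 0 hs0, gaussianReal_of_var_ne_zero 0 ht.ne',
    ← withDensity_mul _ (measurable_gaussianPDF 0 t) (by fun_prop)]
  congr 1
  ext x
  rw [Pi.mul_apply, gaussianPDF, gaussianPDF, ← ENNReal.ofReal_mul (gaussianPDFReal_nonneg _ _ _)]
  congr 1
  simp only [gaussianPDFReal, hs, sub_zero]
  have h1 : (√(2 * Real.pi * (t / (1 + κ * t))))⁻¹ = (√(2 * Real.pi * t))⁻¹ * √(1 + κ * t) := by
    rw [← mul_div_assoc, Real.sqrt_div' _ hk.le, inv_div, div_eq_mul_inv, mul_comm]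
  have h2 : -x ^ 2 / (2 * (t / (1 + κ * t))) = -x ^ 2 / (2 * t) + -(κ / 2) * x ^ 2 := by
    field_simp
    ring
  rw [h1, h2, Real.exp_add]
  ring

theorem lintegral_eval_infinitePi {ν : ℕ → Measure ℝ} [∀ i, IsProbabilityMeasure (ν i)] (i : ℕ)
    {f : ℝ → ℝ≥0∞} (hf : Measurable f) :
    ∫⁻ c, f (c i) ∂(Measure.infinitePi ν) = ∫⁻ x, f x ∂(ν i) :=
  (measurePreserving_eval_infinitePi ν i).lintegral_comp hf

theorem lintegral_prod_infinitePi {ν : ℕ → Measure ℝ} [∀ i, IsProbabilityMeasure (ν i)]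
    (s : Finset ℕ) {f : ℕ → ℝ → ℝ≥0∞} (hf : ∀ i, Measurable (f i)) :
    ∫⁻ c, ∏ i ∈ s, f i (c i) ∂(Measure.infinitePi ν) = ∏ i ∈ s, ∫⁻ x, f i x ∂(ν i) := by
  rw [lintegral_prod_eq_prod_lintegral_of_indepFun s (fun i (c : ℕ → ℝ) => f i (c i))
    (iIndepFun_infinitePi hf) (fun i => (hf i).comp (measurable_pi_apply i))]
  exact Finset.prod_congr rfl fun i _ => lintegral_eval_infinitePi i (hf i)

/-- A product measure whose factors have densities with uniformly bounded partial products. -/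
theorem infinitePi_eq_withDensity {μ ν : ℕ → Measure ℝ} [∀ i, IsProbabilityMeasure (μ i)]
    [∀ i, IsProbabilityMeasure (ν i)] {r : ℕ → ℝ → ℝ≥0∞} (hr : ∀ i, Measurable (r i))
    (hμ : ∀ i, μ i = (ν i).withDensity (r i)) {Z : ℝ≥0∞} (hZ : Z ≠ ∞)
    (hbound : ∀ N (c : ℕ → ℝ), ∏ i ∈ Finset.range N, r i (c i) ≤ Z) {D : (ℕ → ℝ) → ℝ≥0∞}
    (hD : ∀ᵐ c ∂(Measure.infinitePi ν),
      Tendsto (fun N => ∏ i ∈ Finset.range N, r i (c i)) atTop (𝓝 (D c))) :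
    Measure.infinitePi μ = (Measure.infinitePi ν).withDensity D := by
  classical
  refine (Measure.eq_infinitePi _ fun s t ht => ?_).symm
  have hmeas : MeasurableSet (Set.pi (s : Set ℕ) t) := MeasurableSet.pi s.countable_toSet fun i _ => ht i
  rw [withDensity_apply _ hmeas]
  have hlim : Tendsto (fun N => ∫⁻ c in Set.pi (s : Set ℕ) t, ∏ i ∈ Finset.range N, r i (c i)
      ∂(Measure.infinitePi ν)) atTop (𝓝 (∫⁻ c in Set.pi (s : Set ℕ) t, D c ∂(Measure.infinitePi ν))) := by
    refine tendsto_lintegral_of_dominated_convergence (fun _ => Z) (fun N => ?_)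
      (fun N => Eventually.of_forall (hbound N)) ?_ (ae_restrict_of_ae hD)
    · exact Finset.measurable_prod _ fun i _ => (hr i).comp (measurable_pi_apply i)
    · rw [lintegral_const]
      exact ENNReal.mul_ne_top hZ (measure_ne_top _ _)
  -- The integral of the N-th partial product over the cylinder is already constant once `range N`
  -- contains s, as every further factor integrates to 1.
  refine tendsto_nhds_unique hlim (tendsto_const_nhds.congr' ?_)
  obtain ⟨N₀, hN₀⟩ := s.exists_nat_subset_range
  filter_upwards [eventually_ge_atTop N₀] with N hN
  have hsub : s ⊆ Finset.range N := hN₀.trans (Finset.range_mono hN)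
  -- The indicator of the box is distributed over the factors, so that independence applies.
  have hind : ∀ c : ℕ → ℝ, (Set.pi (s : Set ℕ) t).indicator
      (fun c => ∏ i ∈ Finset.range N, r i (c i)) c =
      ∏ i ∈ Finset.range N, (if i ∈ s then (t i).indicator (r i) else r i) (c i) := fun c => by
    by_cases hc : c ∈ Set.pi (s : Set ℕ) t
    · rw [indicator_of_mem hc]
      refine Finset.prod_congr rfl fun i _ => ?_
      split_ifs with hi
      · rw [indicator_of_mem (hc i hi)]
      · rfl
    · rw [indicator_of_notMem hc]
      simp only [Set.mem_pi, not_forall] at hc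
      obtain ⟨i, hi, hci⟩ := hc
      have hi' : i ∈ s := hi
      refine (Finset.prod_eq_zero (hsub hi') ?_).symm
      rw [if_pos hi', indicator_of_notMem hci]
  rw [← lintegral_indicator hmeas, lintegral_congr hind, lintegral_prod_infinitePi]
  · have hf : ∀ i, ∫⁻ x, (if i ∈ s then (t i).indicator (r i) else r i) x ∂(ν i) =
        if i ∈ s then μ i (t i) else 1 := fun i => by
      split_ifs with hi
      · rw [lintegral_indicator (ht i), hμ i, withDensity_apply _ (ht i)]
      · rw [← setLIntegral_univ, ← withDensity_apply _ MeasurableSet.univ, ← hμ i, measure_univ]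
    simp only [hf]
    rw [Finset.prod_ite_mem, Finset.inter_eq_right.2 hsub]
  · intro i
    split_ifs
    · exact (hr i).indicator (ht i)
    · exact hr i

theorem lintegral_sq_gaussianReal (v : ℝ≥0) :
    ∫⁻ x, ENNReal.ofReal (x ^ 2) ∂(gaussianReal 0 v) = v := by
  have h1 : ∫ x, x ^ 2 ∂(gaussianReal 0 v) = v := by
    have := variance_of_integral_eq_zero (μ := gaussianReal 0 v) (X := id) aemeasurable_id
      (by simp)
    rw [variance_id_gaussianReal] at this
    simpa using this.symm
  have hi : Integrable (fun x : ℝ => x ^ 2) (gaussianReal 0 v) := by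
    simpa using (memLp_id_gaussianReal (μ := 0) (v := v) 2).integrable_sq
  rw [← ofReal_integral_eq_lintegral_ofReal hi (Eventually.of_forall fun x => sq_nonneg x), h1,
    ENNReal.ofReal_coe_nnreal]

/-- The expectation of ∑ a_i c_i² is ∑ a_i v_i; a nonnegative variable with finite expectation is
almost surely finite. -/
theorem ae_summable_mul_sq {v : ℕ → ℝ≥0} {a : ℕ → ℝ} (ha : ∀ i, 0 ≤ a i)
    (hs : Summable fun i => a i * v i) :
    ∀ᵐ c ∂(Measure.infinitePi fun i => gaussianReal 0 (v i)), Summable fun i => a i * c i ^ 2 := by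
  have hm : ∀ i, Measurable fun x : ℝ => ENNReal.ofReal (a i * x ^ 2) := fun i => by fun_prop
  have hm' : ∀ i, Measurable fun c : ℕ → ℝ => ENNReal.ofReal (a i * c i ^ 2) :=
    fun i => (hm i).comp (measurable_pi_apply i)
  have hint : ∫⁻ c, ∑' i, ENNReal.ofReal (a i * c i ^ 2)
      ∂(Measure.infinitePi fun i => gaussianReal 0 (v i)) ≠ ∞ := by
    rw [lintegral_tsum fun i => (hm' i).aemeasurable]
    have : ∀ i, ∫⁻ c : ℕ → ℝ, ENNReal.ofReal (a i * c i ^ 2)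
        ∂(Measure.infinitePi fun i => gaussianReal 0 (v i)) = ENNReal.ofReal (a i * v i) :=
      fun i => by
        rw [lintegral_eval_infinitePi (ν := fun i => gaussianReal 0 (v i)) i (hm i)]
        simp_rw [ENNReal.ofReal_mul (ha i)]
        rw [lintegral_const_mul _ (by fun_prop), lintegral_sq_gaussianReal,
          ENNReal.ofReal_coe_nnreal]
    simp only [this]
    rw [← ENNReal.ofReal_tsum_of_nonneg (fun i => mul_nonneg (ha i) (NNReal.coe_nonneg (v i))) hs]
    exact ENNReal.ofReal_ne_top
  have hmt : Measurable fun c : ℕ → ℝ => ∑' i, ENNReal.ofReal (a i * c i ^ 2) :=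
    Measurable.tsum hm'
  filter_upwards [ae_lt_top hmt hint] with c hc
  have := ENNReal.summable_toReal hc.ne
  refine this.congr fun i => ?_
  rw [ENNReal.toReal_ofReal (mul_nonneg (ha i) (sq_nonneg _))]

/-- Exponential moments of a linear functional of a Gaussian sequence. -/
theorem lintegral_exp_tsum_ne_top {v : ℕ → ℝ≥0} {l : ℕ → ℝ}
    (hs : Summable fun i => v i * l i ^ 2)
    (hl : ∀ᵐ c ∂(Measure.infinitePi fun i => gaussianReal 0 (v i)), Summable fun i => c i * l i) :
    ∫⁻ c, ENNReal.ofReal (Real.exp (∑' i, c i * l i))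
      ∂(Measure.infinitePi fun i => gaussianReal 0 (v i)) ≠ ∞ := by
  have h1 : ∀ i, ∫⁻ x, ENNReal.ofReal (Real.exp (x * l i)) ∂(gaussianReal 0 (v i)) =
      ENNReal.ofReal (Real.exp (v i * l i ^ 2 / 2)) := fun i => by
    have hmgf := congrFun (mgf_fun_id_gaussianReal (μ := 0) (v := v i)) (l i)
    rw [mgf] at hmgf
    simp only [zero_mul, zero_add] at hmgf
    have hint := integrable_exp_mul_gaussianReal (μ := 0) (v := v i) (l i)
    rw [← hmgf, ofReal_integral_eq_lintegral_ofReal hint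
      (Eventually.of_forall fun x => (Real.exp_pos _).le)]
    simp only [mul_comm]
  have hexp : ∀ N (c : ℕ → ℝ), ENNReal.ofReal (Real.exp (∑ i ∈ Finset.range N, c i * l i)) =
      ∏ i ∈ Finset.range N, ENNReal.ofReal (Real.exp (c i * l i)) := fun N c => by
    rw [Real.exp_sum, ENNReal.ofReal_prod_of_nonneg fun i _ => (Real.exp_pos _).le]
  have h2 : ∀ N, ∫⁻ c, ENNReal.ofReal (Real.exp (∑ i ∈ Finset.range N, c i * l i))
      ∂(Measure.infinitePi fun i => gaussianReal 0 (v i)) ≤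
      ENNReal.ofReal (Real.exp (∑' i, v i * l i ^ 2 / 2)) := fun N => by
    simp only [hexp]
    rw [lintegral_prod_infinitePi (ν := fun i => gaussianReal 0 (v i))
      (f := fun i x => ENNReal.ofReal (Real.exp (x * l i))) _ fun i => by fun_prop]
    simp only [h1]
    rw [← ENNReal.ofReal_prod_of_nonneg fun i _ => (Real.exp_pos _).le, ← Real.exp_sum]
    refine ENNReal.ofReal_le_ofReal (Real.exp_le_exp.2 ?_)
    exact (hs.div_const 2).sum_le_tsum _ fun i _ =>
      div_nonneg (mul_nonneg (NNReal.coe_nonneg (v i)) (sq_nonneg _)) zero_le_two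
  -- Fatou's lemma suffices, as the expectations of the partial exponentials are bounded uniformly
  -- in N.
  have hfatou : ∫⁻ c, ENNReal.ofReal (Real.exp (∑' i, c i * l i))
      ∂(Measure.infinitePi fun i => gaussianReal 0 (v i)) ≤
      liminf (fun N => ∫⁻ c, ENNReal.ofReal (Real.exp (∑ i ∈ Finset.range N, c i * l i))
        ∂(Measure.infinitePi fun i => gaussianReal 0 (v i))) atTop := by
    refine le_trans (le_of_eq (lintegral_congr_ae ?_)) (lintegral_liminf_le fun N => by fun_prop)
    filter_upwards [hl] with c hc
    refine (Tendsto.liminf_eq ?_).symm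
    exact ENNReal.tendsto_ofReal ((Real.continuous_exp.tendsto _).comp hc.hasSum.tendsto_sum_nat)
  refine ne_top_of_le_ne_top (ENNReal.ofReal_ne_top
    (r := Real.exp (∑' i, v i * l i ^ 2 / 2))) (hfatou.trans ?_)
  exact (liminf_le_liminf (Eventually.of_forall h2)).trans_eq (liminf_const _)

theorem multipliable_sqrt_one_add {x : ℕ → ℝ} (hx : ∀ i, 0 ≤ x i) (hs : Summable x) :
    Multipliable fun i => √(1 + x i) := by
  have h1 : Summable fun i => √(1 + x i) - 1 := by
    refine Summable.of_nonneg_of_le (fun i => ?_) (fun i => ?_) hs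
    · exact sub_nonneg.2 (Real.one_le_sqrt.2 (by linarith [hx i]))
    · have : √(1 + x i) ≤ 1 + x i := by
        rw [Real.sqrt_le_left (by linarith [hx i])]
        nlinarith [hx i]
      linarith
  refine (Real.multipliable_one_add_of_summable h1).congr fun i => by ring

theorem prod_range_sqrt_le_tprod {x : ℕ → ℝ} (hx : ∀ i, 0 ≤ x i) (hs : Summable x) (N : ℕ) :
    ∏ i ∈ Finset.range N, √(1 + x i) ≤ ∏' i, √(1 + x i) := by
  have h := (multipliable_sqrt_one_add hx hs).hasProd.tendsto_prod_nat
  refine Monotone.ge_of_tendsto (monotone_nat_of_le_succ fun n => ?_) h N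
  rw [Finset.prod_range_succ]
  exact le_mul_of_one_le_right (Finset.prod_nonneg fun i _ => Real.sqrt_nonneg _)
    (Real.one_le_sqrt.2 (by linarith [hx n]))

theorem tprod_sqrt_pos {x : ℕ → ℝ} (hx : ∀ i, 0 ≤ x i) (hs : Summable x) :
    0 < ∏' i, √(1 + x i) :=
  zero_lt_one.trans_le (by simpa using prod_range_sqrt_le_tprod hx hs 0)

/-- The density between two Gaussian sequences whose variances are related by tilting. -/
theorem infinitePi_gaussian_eq_withDensity {t s : ℕ → ℝ≥0} (ht : ∀ i, 0 < t i) {κ : ℝ}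
    (hκ : 0 ≤ κ) {γ : ℕ → ℝ} (hγ : ∀ i, 0 ≤ γ i) (hs : ∀ i, (s i : ℝ) = t i / (1 + κ * γ i * t i))
    (hsum : Summable fun i => γ i * t i) :
    Measure.infinitePi (fun i => gaussianReal 0 (s i)) =
      (Measure.infinitePi fun i => gaussianReal 0 (t i)).withDensity fun c =>
        ENNReal.ofReal ((∏' i, √(1 + κ * γ i * t i)) *
          Real.exp (-(κ / 2) * ∑' i, γ i * c i ^ 2)) := by
  have hx : ∀ i, 0 ≤ κ * γ i * t i := fun i =>
    mul_nonneg (mul_nonneg hκ (hγ i)) (NNReal.coe_nonneg _)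
  have hxs : Summable fun i => κ * γ i * t i := by
    simpa only [mul_assoc] using hsum.mul_left κ
  have hprod : ∀ N (c : ℕ → ℝ), ∏ i ∈ Finset.range N,
      ENNReal.ofReal (√(1 + κ * γ i * t i) * Real.exp (-(κ * γ i / 2) * c i ^ 2)) =
      ENNReal.ofReal ((∏ i ∈ Finset.range N, √(1 + κ * γ i * t i)) *
        Real.exp (-(κ / 2) * ∑ i ∈ Finset.range N, γ i * c i ^ 2)) := fun N c => by
    rw [← ENNReal.ofReal_prod_of_nonneg fun i _ =>
      mul_nonneg (Real.sqrt_nonneg _) (Real.exp_pos _).le, Finset.prod_mul_distrib,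
      ← Real.exp_sum, Finset.mul_sum]
    congr 4
    ext i
    ring
  refine infinitePi_eq_withDensity
    (r := fun i x => ENNReal.ofReal (√(1 + κ * γ i * t i) * Real.exp (-(κ * γ i / 2) * x ^ 2)))
    (fun i => by fun_prop)
    (fun i => gaussianReal_eq_withDensity (ht i) (mul_nonneg hκ (hγ i)) (hs i))
    -- The exponentials are at most 1 and the square roots at least 1, so the full product of the
    -- square roots dominates every partial product.
    (Z := ENNReal.ofReal (∏' i, √(1 + κ * γ i * t i))) ENNReal.ofReal_ne_top (fun N c => ?_) ?_
  · rw [hprod]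
    refine ENNReal.ofReal_le_ofReal ?_
    refine (mul_le_of_le_one_right (Finset.prod_nonneg fun i _ => Real.sqrt_nonneg _)
      (Real.exp_le_one_iff.2 ?_)).trans (prod_range_sqrt_le_tprod hx hxs N)
    have : 0 ≤ ∑ i ∈ Finset.range N, γ i * c i ^ 2 :=
      Finset.sum_nonneg fun i _ => mul_nonneg (hγ i) (sq_nonneg _)
    nlinarith [mul_nonneg hκ this]
  · filter_upwards [ae_summable_mul_sq hγ hsum] with c hc
    simp only [hprod]
    refine ENNReal.tendsto_ofReal (Tendsto.mul ?_ ?_)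
    · exact (multipliable_sqrt_one_add hx hxs).hasProd.tendsto_prod_nat
    · exact (Real.continuous_exp.tendsto _).comp (hc.hasSum.tendsto_sum_nat.const_mul _)

/-! ### Measurability on the Sobolev space -/

theorem measurable_eval_sobolev {m : ℕ} (t : unitInterval) :
    Measurable fun f : sobolev m => (f : unitInterval → ℝ) t :=
  (measurable_pi_apply t).comp measurable_subtype_coe

theorem measurable_formV_sobolev {m : ℕ} (hm : 1 ≤ m) {A : ℝ → ℝ} {f₀ p : unitInterval → ℝ}
    {c₁ c₂ : ℝ} (W : WeightBounds A f₀ p c₁ c₂) {g : unitInterval → ℝ} (hg : Continuous g) :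
    Measurable fun f : sobolev m => formV A f₀ p f g := by
  simp only [formV_eq]
  -- Evaluation is measurable in f for fixed x and continuous in x for fixed f, hence jointly
  -- measurable; the integral over x is then measurable in f.
  have h1 : Measurable (Function.uncurry fun (x : unitInterval) (f : sobolev m) =>
      (f : unitInterval → ℝ) x) :=
    measurable_uncurry_of_continuous_of_measurable
      (fun f => continuous_of_mem_sobolev hm f.2) fun x => measurable_eval_sobolev x
  have h2 : Measurable fun q : sobolev m × unitInterval => (q.1 : unitInterval → ℝ) q.2 :=
    h1.comp measurable_swap
  have h3 : Measurable (Function.uncurry fun (f : sobolev m) (x : unitInterval) =>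
      iteratedDeriv 2 A (f₀ x) * p x * ((f : unitInterval → ℝ) x * g x)) :=
    (W.meas.comp measurable_snd).mul (h2.mul (hg.measurable.comp measurable_snd))
  exact h3.stronglyMeasurable.integral_prod_right.measurable

theorem measurableSet_summable_mul_sq {α : Type*} [MeasurableSpace α] {a : ℕ → ℝ}
    (ha : ∀ i, 0 ≤ a i) {c : ℕ → α → ℝ} (hc : ∀ i, Measurable (c i)) :
    MeasurableSet {x | Summable fun i => a i * c i x ^ 2} := by
  have hmeas : Measurable fun x => ∑' i, ENNReal.ofReal (a i * c i x ^ 2) :=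
    Measurable.tsum fun i => (((hc i).pow_const 2).const_mul (a i)).ennreal_ofReal
  have : {x | Summable fun i => a i * c i x ^ 2} =
      {x | ∑' i, ENNReal.ofReal (a i * c i x ^ 2) < ∞} := by
    ext x
    simp only [mem_ofPred_eq]
    constructor
    · intro h
      rw [← ENNReal.ofReal_tsum_of_nonneg (fun i => mul_nonneg (ha i) (sq_nonneg _)) h]
      exact ENNReal.ofReal_lt_top
    · intro h
      refine (ENNReal.summable_toReal h.ne).congr fun i => ?_
      rw [ENNReal.toReal_ofReal (mul_nonneg (ha i) (sq_nonneg _))]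
  rw [this]
  exact measurableSet_lt hmeas measurable_const

theorem measurable_eigenSeries (φ : ℕ → unitInterval → ℝ) (t : unitInterval) :
    Measurable fun c : ℕ → ℝ => eigenSeries φ c t :=
  Measurable.tsum fun i => (measurable_pi_apply i).mul_const _

open Classical in
/-- The sum `∑_ν c_ν φ_ν` as an element of the Sobolev space. -/
noncomputable def seriesMap (m : ℕ) (φ : ℕ → unitInterval → ℝ) (ρ : ℕ → ℝ) (c : ℕ → ℝ) :
    sobolev m :=
  -- Testing summability, a measurable condition on c that implies membership in S^m, keeps the map
  -- measurable.
  if Summable fun ν => (1 + ρ ν) * c ν ^ 2 then toSobolev m (eigenSeries φ c)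
  else ⟨0, zero_mem_sobolev m⟩

namespace IsEigensystem

variable {m : ℕ} {A : ℝ → ℝ} {f₀ p : unitInterval → ℝ} {φ : ℕ → unitInterval → ℝ} {ρ : ℕ → ℝ}
  {c₁ c₂ : ℝ}

theorem one_add_rho_nonneg (E : IsEigensystem m A f₀ p φ ρ) (ν : ℕ) : 0 ≤ 1 + ρ ν := by
  linarith [E.rho_nonneg ν]

theorem penaltyCoeff_nonneg (E : IsEigensystem m A f₀ p φ ρ) (ν : ℕ) :
    0 ≤ penaltyCoeff m ρ ν := by
  unfold penaltyCoeff
  split_ifs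
  · exact zero_le_one
  · exact E.rho_nonneg ν

theorem penaltyCoeff_le (E : IsEigensystem m A f₀ p φ ρ) (ν : ℕ) :
    penaltyCoeff m ρ ν ≤ 1 + ρ ν := by
  unfold penaltyCoeff
  split_ifs
  · linarith [E.rho_nonneg ν]
  · linarith

theorem coe_seriesMap (E : IsEigensystem m A f₀ p φ ρ) (hm : 1 ≤ m)
    (W : WeightBounds A f₀ p c₁ c₂) {c : ℕ → ℝ} (hc : Summable fun ν => (1 + ρ ν) * c ν ^ 2) :
    (seriesMap m φ ρ c : unitInterval → ℝ) = eigenSeries φ c := by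
  unfold seriesMap toSobolev
  rw [if_pos hc, dif_pos (E.eigenSeries_spec hm W hc).1]

theorem measurableSet_summable (E : IsEigensystem m A f₀ p φ ρ) :
    MeasurableSet {c : ℕ → ℝ | Summable fun ν => (1 + ρ ν) * c ν ^ 2} :=
  measurableSet_summable_mul_sq (c := fun i (x : ℕ → ℝ) => x i) E.one_add_rho_nonneg
    fun i => measurable_pi_apply i

theorem measurable_seriesMap (E : IsEigensystem m A f₀ p φ ρ) (hm : 1 ≤ m)
    (W : WeightBounds A f₀ p c₁ c₂) : Measurable (seriesMap m φ ρ) := by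
  classical
  suffices h : Measurable fun c => (seriesMap m φ ρ c : unitInterval → ℝ) from
    h.subtype_mk (h := fun c => (seriesMap m φ ρ c).2)
  refine measurable_pi_iff.2 fun t => ?_
  have : (fun c => (seriesMap m φ ρ c : unitInterval → ℝ) t) = fun c =>
      if Summable fun ν => (1 + ρ ν) * c ν ^ 2 then eigenSeries φ c t else 0 := by
    ext c
    split_ifs with h
    · rw [E.coe_seriesMap hm W h]
    · rw [seriesMap, if_neg h]
      rfl
  rw [this]
  exact Measurable.ite E.measurableSet_summable (measurable_eigenSeries φ t) measurable_const

end IsEigensystem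

/-! ### Gaussian series as random elements of the Sobolev space -/

/-- The law of the Gaussian series with coefficient variances `v`. -/
noncomputable def seriesLaw (m : ℕ) (φ : ℕ → unitInterval → ℝ) (ρ : ℕ → ℝ) (v : ℕ → ℝ≥0) :
    Measure (sobolev m) :=
  (Measure.infinitePi fun i => gaussianReal 0 (v i)).map (seriesMap m φ ρ)

theorem add_deriv_mul_le_of_iteratedDeriv_two_pos {A : ℝ → ℝ} (hA : ContDiff ℝ 3 A)
    (hA2 : ∀ z, 0 < iteratedDeriv 2 A z) (z : ℝ) : A 0 + deriv A 0 * z ≤ A z := by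
  have hd : Differentiable ℝ A := hA.differentiable (by norm_num)
  have hd' : Differentiable ℝ (deriv A) :=
    ((contDiff_succ_iff_deriv (n := 2)).1 (hA.of_le (by norm_num))).2.2.differentiable (by norm_num)
  have hconv : ConvexOn ℝ univ A := convexOn_univ_of_deriv2_nonneg hd hd' fun x => by
    rw [← iteratedDeriv_eq_iterate]
    exact (hA2 x).le
  rcases lt_trichotomy z 0 with h | rfl | h
  · have := hconv.slope_le_of_hasDerivAt (mem_univ z) (mem_univ 0) h (hd 0).hasDerivAt
    rw [slope_def_field, div_le_iff₀ (by linarith)] at this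
    linarith
  · simp
  · have := hconv.le_slope_of_hasDerivAt (mem_univ 0) (mem_univ z) h (hd 0).hasDerivAt
    rw [slope_def_field, le_div_iff₀ (by linarith)] at this
    linarith

theorem measurable_logLik {m n : ℕ} {A : ℝ → ℝ} (hA : Continuous A) (x : Fin n → unitInterval)
    (y : Fin n → ℝ) : Measurable fun f : sobolev m => logLik A x y f := by
  unfold logLik
  exact Finset.measurable_sum _ fun i _ =>
    ((measurable_eval_sobolev (x i)).const_mul (y i)).sub
      (hA.measurable.comp (measurable_eval_sobolev (x i)))

/-- A convex function lies above its tangent at 0. The resulting bound is affine in f, so its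
exponential is integrable for a Gaussian law. -/
theorem logLik_le {n : ℕ} {A : ℝ → ℝ} (hA : ContDiff ℝ 3 A) (hA2 : ∀ z, 0 < iteratedDeriv 2 A z)
    (x : Fin n → unitInterval) (y : Fin n → ℝ) (f : unitInterval → ℝ) :
    logLik A x y f ≤ ∑ i, (y i - deriv A 0) * f (x i) + -(n * A 0) := by
  have : -(n * A 0) = ∑ _i : Fin n, -A 0 := by simp
  rw [this, ← Finset.sum_add_distrib]
  refine Finset.sum_le_sum fun i _ => ?_
  linarith [add_deriv_mul_le_of_iteratedDeriv_two_pos hA hA2 (f (x i))]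

theorem lintegral_ofReal_exp_ne_zero {α : Type*} [MeasurableSpace α] {μ : Measure α}
    [IsProbabilityMeasure μ] {g : α → ℝ} (hg : Measurable g) :
    ∫⁻ a, ENNReal.ofReal (Real.exp (g a)) ∂μ ≠ 0 := by
  rw [Ne, lintegral_eq_zero_iff (by fun_prop)]
  intro h
  obtain ⟨a, ha⟩ := h.exists
  simp only [Pi.zero_apply, ENNReal.ofReal_eq_zero] at ha
  exact absurd (Real.exp_pos (g a)) (not_lt.2 ha)

namespace IsEigensystem

variable {m : ℕ} {A : ℝ → ℝ} {f₀ p : unitInterval → ℝ} {φ : ℕ → unitInterval → ℝ} {ρ : ℕ → ℝ}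
  {c₁ c₂ : ℝ} {v : ℕ → ℝ≥0}

theorem isProbabilityMeasure_seriesLaw (E : IsEigensystem m A f₀ p φ ρ) (hm : 1 ≤ m)
    (W : WeightBounds A f₀ p c₁ c₂) : IsProbabilityMeasure (seriesLaw m φ ρ v) :=
  Measure.isProbabilityMeasure_map (E.measurable_seriesMap hm W).aemeasurable

theorem ae_summable (E : IsEigensystem m A f₀ p φ ρ)
    (hv : Summable fun ν => (1 + ρ ν) * (v ν : ℝ)) :
    ∀ᵐ c ∂(Measure.infinitePi fun i => gaussianReal 0 (v i)),
      Summable fun ν => (1 + ρ ν) * c ν ^ 2 :=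
  ae_summable_mul_sq E.one_add_rho_nonneg hv

/-- The law of the random series, as a push-forward of a Gaussian sequence. -/
theorem sobolevLaw_randomSeries (E : IsEigensystem m A f₀ p φ ρ) (hm : 1 ≤ m)
    (W : WeightBounds A f₀ p c₁ c₂) (hv : Summable fun ν => (1 + ρ ν) * (v ν : ℝ))
    {Ω : Type*} [MeasurableSpace Ω] {P : Measure Ω} {ξ : ℕ → Ω → ℝ} (hind : iIndepFun ξ P)
    (hξ : ∀ ν, HasLaw (ξ ν) (gaussianReal 0 (v ν)) P) :
    (∀ᵐ ω ∂P, (∀ t, Summable fun ν => ξ ν ω * φ ν t) ∧ randomSeries φ ξ ω ∈ sobolev m) ∧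
      sobolevLaw P m (randomSeries φ ξ) = seriesLaw m φ ρ v := by
  have hme : AEMeasurable (fun ω i => ξ i ω) P := aemeasurable_pi_iff.2 fun i => (hξ i).aemeasurable
  have hlaw := hind.hasLaw_infinitePi hξ hme
  have hae : ∀ᵐ ω ∂P, Summable fun ν => (1 + ρ ν) * ξ ν ω ^ 2 := by
    have := E.ae_summable hv
    rw [← hlaw.map_eq] at this
    exact ae_of_ae_map hme this
  refine ⟨?_, ?_⟩
  · filter_upwards [hae] with ω hω
    exact ⟨E.summable_eigenSeries hm W hω, (E.eigenSeries_spec hm W hω).1⟩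
  · unfold sobolevLaw seriesLaw
    rw [← hlaw.map_eq, AEMeasurable.map_map_of_aemeasurable
      (E.measurable_seriesMap hm W).aemeasurable hme]
    refine Measure.map_congr ?_
    filter_upwards [hae] with ω hω
    rw [Function.comp_apply, seriesMap, if_pos hω]
    rfl

/-- Under the law of the series, almost every function is the sum of its eigenfunction
expansion. -/
theorem ae_eq_eigenSeries (E : IsEigensystem m A f₀ p φ ρ) (hm : 1 ≤ m)
    (W : WeightBounds A f₀ p c₁ c₂) (hv : Summable fun ν => (1 + ρ ν) * (v ν : ℝ)) :
    ∀ᵐ f : sobolev m ∂(seriesLaw m φ ρ v), (Summable fun ν => (1 + ρ ν) * formV A f₀ p f (φ ν) ^ 2) ∧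
      (f : unitInterval → ℝ) = eigenSeries φ fun ν => formV A f₀ p f (φ ν) := by
  have hcoef : ∀ ν, Measurable fun f : sobolev m => formV A f₀ p f (φ ν) := fun ν =>
    measurable_formV_sobolev hm W (E.continuous hm ν)
  -- Equality at countably many points is a measurable event for the σ-algebra of point evaluations;
  -- continuity of both sides then extends it to the whole interval.
  set d := TopologicalSpace.denseSeq unitInterval
  have hall : ∀ᵐ f : sobolev m ∂(seriesLaw m φ ρ v),
      (Summable fun ν => (1 + ρ ν) * formV A f₀ p f (φ ν) ^ 2) ∧
      ∀ k, (f : unitInterval → ℝ) (d k) = eigenSeries φ (fun ν => formV A f₀ p f (φ ν)) (d k) := by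
    unfold seriesLaw
    rw [ae_map_iff (E.measurable_seriesMap hm W).aemeasurable]
    · filter_upwards [E.ae_summable hv] with c hc
      rw [E.coe_seriesMap hm W hc]
      simp only [E.formV_eigenSeries hm W hc]
      exact ⟨hc, fun k => trivial⟩
    · refine (measurableSet_summable_mul_sq E.one_add_rho_nonneg hcoef).inter ?_
      have : {f : sobolev m | ∀ k, (f : unitInterval → ℝ) (d k) =
          eigenSeries φ (fun ν => formV A f₀ p f (φ ν)) (d k)} =
          ⋂ k, {f : sobolev m | (f : unitInterval → ℝ) (d k) =
            eigenSeries φ (fun ν => formV A f₀ p f (φ ν)) (d k)} := by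
        ext f
        simp
      change MeasurableSet {f : sobolev m | ∀ k, (f : unitInterval → ℝ) (d k) =
          eigenSeries φ (fun ν => formV A f₀ p f (φ ν)) (d k)}
      rw [this]
      refine MeasurableSet.iInter fun k => measurableSet_eq_fun (measurable_eval_sobolev _) ?_
      exact (measurable_eigenSeries φ (d k)).comp (measurable_pi_iff.2 hcoef)
  filter_upwards [hall] with f hf
  refine ⟨hf.1, ?_⟩
  have hs := (E.eigenSeries_spec hm W hf.1).1
  exact Continuous.ext_on (TopologicalSpace.denseRange_denseSeq unitInterval)
    (continuous_of_mem_sobolev hm f.2) (continuous_of_mem_sobolev hm hs) (by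
      rintro _ ⟨k, rfl⟩
      exact hf.2 k)

theorem ae_formJ_eq (E : IsEigensystem m A f₀ p φ ρ) (hm : 1 ≤ m)
    (W : WeightBounds A f₀ p c₁ c₂) (hv : Summable fun ν => (1 + ρ ν) * (v ν : ℝ)) :
    ∀ᵐ f : sobolev m ∂(seriesLaw m φ ρ v), formJ m A f₀ p f f =
      ∑' ν, penaltyCoeff m ρ ν * formV A f₀ p f (φ ν) ^ 2 := by
  filter_upwards [E.ae_eq_eigenSeries hm W hv] with f hf
  rw [(E.hasSum_formJ hm W hf.1).tsum_eq, ← hf.2]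

/-- The density between the coefficient sequences depends only on the numbers V(f, φ_ν), so it
factors through the series map and survives the push-forward. `D` is built from these measurable
coefficients; J, defined by a choice of projection, enters only through almost everywhere equality.
-/
theorem seriesLaw_eq_withDensity (E : IsEigensystem m A f₀ p φ ρ) (hm : 1 ≤ m)
    (W : WeightBounds A f₀ p c₁ c₂) {t s : ℕ → ℝ≥0} (ht : ∀ i, 0 < t i) {κ : ℝ} (hκ : 0 ≤ κ)
    (hs : ∀ i, (s i : ℝ) = t i / (1 + κ * penaltyCoeff m ρ i * t i))
    (hsum : Summable fun ν => (1 + ρ ν) * (t ν : ℝ)) :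
    ∃ D : sobolev m → ℝ≥0∞, Measurable D ∧
      seriesLaw m φ ρ s = (seriesLaw m φ ρ t).withDensity D ∧
      ∀ᵐ f : sobolev m ∂(seriesLaw m φ ρ t), D f = ENNReal.ofReal
        ((∏' i, √(1 + κ * penaltyCoeff m ρ i * t i)) *
          Real.exp (-(κ / 2) * formJ m A f₀ p f f)) := by
  have hcoef : ∀ ν, Measurable fun f : sobolev m => formV A f₀ p f (φ ν) := fun ν =>
    measurable_formV_sobolev hm W (E.continuous hm ν)
  have hγsum : Summable fun i => penaltyCoeff m ρ i * t i :=
    Summable.of_nonneg_of_le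
      (fun i => mul_nonneg (E.penaltyCoeff_nonneg i) (NNReal.coe_nonneg _))
      (fun i => mul_le_mul_of_nonneg_right (E.penaltyCoeff_le i) (NNReal.coe_nonneg _)) hsum
  have hD : Measurable fun f : sobolev m => ENNReal.ofReal
      ((∏' i, √(1 + κ * penaltyCoeff m ρ i * t i)) *
        Real.exp (-(κ / 2) * ∑' ν, penaltyCoeff m ρ ν * formV A f₀ p f (φ ν) ^ 2)) := by
    have : Measurable fun f : sobolev m =>
        ∑' ν, penaltyCoeff m ρ ν * formV A f₀ p f (φ ν) ^ 2 :=
      Measurable.tsum fun i => ((hcoef i).pow_const 2).const_mul _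
    fun_prop
  have hT := E.measurable_seriesMap hm W
  refine ⟨_, hD, ?_, ?_⟩
  · ext B hB
    rw [withDensity_apply _ hB, seriesLaw, seriesLaw, setLIntegral_map hB hD hT,
      Measure.map_apply hT hB,
      infinitePi_gaussian_eq_withDensity ht hκ E.penaltyCoeff_nonneg hs hγsum,
      withDensity_apply _ (hT hB)]
    refine lintegral_congr_ae (ae_restrict_of_ae ?_)
    filter_upwards [E.ae_summable hsum] with c hc
    rw [E.coe_seriesMap hm W hc]
    simp only [E.formV_eigenSeries hm W hc]
  · filter_upwards [E.ae_formJ_eq hm W hsum] with f hf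
    rw [hf]

theorem lintegral_exp_logLik_ne_top (E : IsEigensystem m A f₀ p φ ρ) (hm : 1 ≤ m)
    (W : WeightBounds A f₀ p c₁ c₂) (hv : Summable fun ν => (1 + ρ ν) * (v ν : ℝ))
    (hA : ContDiff ℝ 3 A) (hA2 : ∀ z, 0 < iteratedDeriv 2 A z) {n : ℕ}
    (x : Fin n → unitInterval) (y : Fin n → ℝ) :
    ∫⁻ f : sobolev m, ENNReal.ofReal (Real.exp (logLik A x y f)) ∂(seriesLaw m φ ρ v) ≠ ∞ := by
  have hL : Measurable fun f : sobolev m => ENNReal.ofReal (Real.exp (logLik A x y f)) :=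
    (measurable_logLik hA.continuous x y).exp.ennreal_ofReal
  unfold seriesLaw
  rw [lintegral_map hL (E.measurable_seriesMap hm W)]
  set l : ℕ → ℝ := fun ν => ∑ i, (y i - deriv A 0) * φ ν (x i) with hl
  have hlin : ∀ c : ℕ → ℝ, (Summable fun ν => (1 + ρ ν) * c ν ^ 2) →
      HasSum (fun ν => c ν * l ν) (∑ i, (y i - deriv A 0) * eigenSeries φ c (x i)) := fun c hc => by
    have := hasSum_sum (s := Finset.univ) fun (i : Fin n) _ =>
      (E.summable_eigenSeries hm W hc (x i)).hasSum.mul_left (y i - deriv A 0)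
    refine this.congr_fun fun ν => ?_
    simp only [hl, Finset.mul_sum]
    exact Finset.sum_congr rfl fun i _ => by ring
  -- The variance of the linear functional. Here v_ν ≤ S/(1 + ρ_ν), and l_ν² is at most n times a
  -- sum of squares (Cauchy–Schwarz), so `summable_sq_div` at the n points x_i gives a summable
  -- majorant.
  have hls : Summable fun ν => v ν * l ν ^ 2 := by
    set S := ∑' ν, (1 + ρ ν) * (v ν : ℝ) with hS
    have hv0 : ∀ ν, 0 ≤ (1 + ρ ν) * (v ν : ℝ) := fun ν =>
      mul_nonneg (E.one_add_rho_nonneg ν) (NNReal.coe_nonneg _)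
    have hdom : Summable fun ν => S * (n * ∑ i, (y i - deriv A 0) ^ 2 *
        (φ ν (x i) ^ 2 / (1 + ρ ν))) :=
      ((summable_sum fun i _ => (E.summable_sq_div hm W (x i)).mul_left _).mul_left _).mul_left _
    refine Summable.of_nonneg_of_le (fun ν => mul_nonneg (NNReal.coe_nonneg _) (sq_nonneg _))
      (fun ν => ?_) hdom
    have hpos : 0 < 1 + ρ ν := by linarith [E.rho_nonneg ν]
    have h1 : l ν ^ 2 ≤ n * ∑ i, ((y i - deriv A 0) * φ ν (x i)) ^ 2 := by
      have := sq_sum_le_card_mul_sum_sq (s := Finset.univ)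
        (f := fun i : Fin n => (y i - deriv A 0) * φ ν (x i))
      simpa using this
    have h2 : n * ∑ i, (y i - deriv A 0) ^ 2 * (φ ν (x i) ^ 2 / (1 + ρ ν)) =
        (n * ∑ i, ((y i - deriv A 0) * φ ν (x i)) ^ 2) / (1 + ρ ν) := by
      rw [mul_div_assoc, Finset.sum_div]
      congr 1
      exact Finset.sum_congr rfl fun i _ => by ring
    rw [h2]
    have h3 : (1 + ρ ν) * (v ν : ℝ) ≤ S := hv.le_tsum ν fun j _ => hv0 j
    calc (v ν : ℝ) * l ν ^ 2 = ((1 + ρ ν) * v ν) * (l ν ^ 2 / (1 + ρ ν)) := by field_simp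
      _ ≤ S * ((n * ∑ i, ((y i - deriv A 0) * φ ν (x i)) ^ 2) / (1 + ρ ν)) := by
        refine mul_le_mul h3 (div_le_div_of_nonneg_right h1 hpos.le)
          (div_nonneg (sq_nonneg _) hpos.le) ((hv0 ν).trans h3)
  have hfin := lintegral_exp_tsum_ne_top hls (by
    filter_upwards [E.ae_summable hv] with c hc using (hlin c hc).summable)
  have hle : ∫⁻ c, ENNReal.ofReal (Real.exp (logLik A x y (seriesMap m φ ρ c)))
      ∂(Measure.infinitePi fun i => gaussianReal 0 (v i)) ≤
      ∫⁻ c, ENNReal.ofReal (Real.exp (-(n * A 0))) * ENNReal.ofReal (Real.exp (∑' i, c i * l i))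
        ∂(Measure.infinitePi fun i => gaussianReal 0 (v i)) := by
    refine lintegral_mono_ae ?_
    filter_upwards [E.ae_summable hv] with c hc
    rw [E.coe_seriesMap hm W hc, (hlin c hc).tsum_eq, ← ENNReal.ofReal_mul (Real.exp_pos _).le,
      ← Real.exp_add]
    refine ENNReal.ofReal_le_ofReal (Real.exp_le_exp.2 ?_)
    linarith [logLik_le hA hA2 x y (eigenSeries φ c)]
  rw [lintegral_const_mul' _ _ ENNReal.ofReal_ne_top] at hle
  exact ne_top_of_le_ne_top (ENNReal.mul_ne_top ENNReal.ofReal_ne_top hfin) hle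

end IsEigensystem

/-! ### The weight bounds and the prior variances -/

theorem exists_weightBounds {m : ℕ} (hm : 1 ≤ m) {A : ℝ → ℝ} (hA : ContDiff ℝ 3 A)
    (hA2 : ∀ z, 0 < iteratedDeriv 2 A z) {f₀ : unitInterval → ℝ} (hf₀ : f₀ ∈ sobolev m)
    {p : unitInterval → ℝ} (hp : Measurable p) {pmin pmax : ℝ} (hpmin : 0 < pmin)
    (hpbd : ∀ x, pmin ≤ p x ∧ p x ≤ pmax) : ∃ c₁ c₂, WeightBounds A f₀ p c₁ c₂ := by
  have hc : Continuous fun x => iteratedDeriv 2 A (f₀ x) :=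
    (hA.continuous_iteratedDeriv 2 (by norm_num)).comp (continuous_of_mem_sobolev hm hf₀)
  obtain ⟨x₁, -, h₁⟩ := isCompact_univ.exists_isMinOn univ_nonempty hc.continuousOn
  obtain ⟨x₂, -, h₂⟩ := isCompact_univ.exists_isMaxOn univ_nonempty hc.continuousOn
  refine ⟨iteratedDeriv 2 A (f₀ x₁) * pmin, iteratedDeriv 2 A (f₀ x₂) * pmax,
    hc.measurable.mul hp, mul_pos (hA2 _) hpmin, fun x => ?_, fun x => ?_⟩
  · exact mul_le_mul (h₁ (mem_univ x)) (hpbd x).1 hpmin.le (hA2 _).le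
  · exact mul_le_mul (h₂ (mem_univ x)) (hpbd x).2 (hpmin.le.trans (hpbd x).1) (hA2 _).le

namespace IsEigensystem

variable {m : ℕ} {A : ℝ → ℝ} {f₀ p : unitInterval → ℝ} {φ : ℕ → unitInterval → ℝ} {ρ : ℕ → ℝ}
  {c₁ c₂ : ℝ} {β : ℝ} {σ : ℕ → ℝ}

theorem tauSq_pos (E : IsEigensystem m A f₀ p φ ρ) (hm : 1 ≤ m) (W : WeightBounds A f₀ p c₁ c₂)
    (hσ : ∀ ν < m, 0 < σ ν) (ν : ℕ) : 0 < tauSq m β σ ρ ν := by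
  unfold tauSq
  split_ifs with h
  · exact inv_pos.2 (pow_pos (hσ ν h) 2)
  · exact Real.rpow_pos_of_pos (E.rho_pos hm W (not_lt.1 h)) _

/-- In both ranges of ν the inverse variance is τ_ν² + nλγ_ν, which is the form required by the
exponential tilt. -/
theorem tunedVar_eq (E : IsEigensystem m A f₀ p φ ρ) (hm : 1 ≤ m) (W : WeightBounds A f₀ p c₁ c₂)
    (hσ : ∀ ν < m, 0 < σ ν) (n : ℕ) {lam : ℝ} (ν : ℕ) :
    tunedVar m n β lam σ ρ ν = 1 / tauSq m β σ ρ ν /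
      (1 + n * lam * penaltyCoeff m ρ ν * (1 / tauSq m β σ ρ ν)) := by
  have hpos := E.tauSq_pos (β := β) hm W hσ ν
  unfold tunedVar penaltyCoeff
  unfold tauSq at hpos ⊢
  split_ifs with h
  · simp
  · rw [if_neg h] at hpos
    generalize ρ ν ^ (1 + β / (2 * m)) = X at hpos ⊢
    rw [div_div]
    congr 1
    field_simp

theorem penaltyCoeff_div_tauSq (E : IsEigensystem m A f₀ p φ ρ) (hm : 1 ≤ m)
    (W : WeightBounds A f₀ p c₁ c₂) (k : ℕ) :
    penaltyCoeff m ρ (m + k) * (1 / tauSq m β σ ρ (m + k)) = ρ (m + k) ^ (-(β / (2 * m))) := by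
  have hρ := E.rho_pos hm W (ν := m + k) (by omega)
  unfold penaltyCoeff tauSq
  rw [if_neg (by omega), if_neg (by omega), Real.rpow_add hρ, Real.rpow_one, Real.rpow_neg hρ.le]
  have := (Real.rpow_pos_of_pos hρ (β / (2 * m))).ne'
  field_simp

theorem summable_one_add_rho_mul (E : IsEigensystem m A f₀ p φ ρ) (hm : 1 ≤ m)
    (W : WeightBounds A f₀ p c₁ c₂) (hσ : ∀ ν < m, 0 < σ ν) (hβ : 1 < β) :
    Summable fun ν => (1 + ρ ν) * (1 / tauSq m β σ ρ ν) := by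
  rw [← summable_nat_add_iff m]
  -- Only the tail matters. There 1 ≤ ρ_{m+k}/ρ_m by monotonicity, so 1 + ρ_{m+k} is at most (1/ρ_m
  -- + 1) ρ_{m+k}.
  have hs := (E.summable_rho_rpow hm W hβ).mul_left ((ρ m)⁻¹ + 1)
  refine Summable.of_nonneg_of_le (fun k => mul_nonneg (E.one_add_rho_nonneg _)
    (one_div_pos.2 (E.tauSq_pos hm W hσ _)).le) (fun k => ?_) hs
  have hρm := E.rho_pos hm W le_rfl
  have hle : ρ m ≤ ρ (m + k) := E.mono (by omega)
  have hτ := one_div_pos.2 (E.tauSq_pos (β := β) hm W hσ (m + k))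
  rw [add_comm k m, ← E.penaltyCoeff_div_tauSq (σ := σ) hm W k, penaltyCoeff, if_neg (by omega),
    ← mul_assoc]
  refine mul_le_mul_of_nonneg_right ?_ hτ.le
  rw [add_mul, one_mul]
  have : 1 ≤ (ρ m)⁻¹ * ρ (m + k) := by
    rw [← div_eq_inv_mul, one_le_div hρm]
    exact hle
  linarith

end IsEigensystem

/-! ### From the density to the posterior -/

/-- The exponents add up: logLik - (nλ/2) J is n times the penalized likelihood. The constant Z does
not depend on B and therefore disappears from the posterior ratio. -/
theorem expMass_withDensity {m n : ℕ} (hn : 1 ≤ n) {A : ℝ → ℝ} (hA : Continuous A)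
    {f₀ p : unitInterval → ℝ} {lam Z : ℝ} (hZ : 0 ≤ Z) {μ : Measure (sobolev m)} [SFinite μ]
    {D : sobolev m → ℝ≥0∞} (hD : Measurable D)
    (hDae : ∀ᵐ f : sobolev m ∂μ, D f =
      ENNReal.ofReal (Z * Real.exp (-(n * lam / 2) * formJ m A f₀ p f f)))
    (x : Fin n → unitInterval) (y : Fin n → ℝ) (B : Set (sobolev m)) :
    expMass (μ.withDensity D) (logLik A x y) B =
      ENNReal.ofReal Z * expMass μ (fun f => n * penLik m A f₀ p lam x y f) B := by
  have hn0 : (n : ℝ) ≠ 0 := by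
    have : n ≠ 0 := by omega
    exact_mod_cast this
  have hL : Measurable fun f : sobolev m => ENNReal.ofReal (Real.exp (logLik A x y f)) :=
    (measurable_logLik hA x y).exp.ennreal_ofReal
  unfold expMass
  rw [restrict_withDensity', lintegral_withDensity_eq_lintegral_mul _ hD hL,
    ← lintegral_const_mul' _ _ ENNReal.ofReal_ne_top]
  refine lintegral_congr_ae (ae_restrict_of_ae ?_)
  filter_upwards [hDae] with f hf
  rw [Pi.mul_apply, hf, ← ENNReal.ofReal_mul hZ,
    ← ENNReal.ofReal_mul (mul_nonneg hZ (Real.exp_pos _).le), mul_assoc, ← Real.exp_add]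
  congr 3
  unfold penLik
  field_simp
  ring

end TuningPrior

theorem mainTheorem4
    (m n : ℕ) (hm : 1 ≤ m) (hn : 1 ≤ n)
    (β lam : ℝ) (hβ : 1 < β) (hlam : 0 ≤ lam)
    (A : ℝ → ℝ) (hA : ContDiff ℝ 3 A) (hA2 : ∀ z, 0 < iteratedDeriv 2 A z)
    (f₀ : unitInterval → ℝ) (hf₀ : f₀ ∈ TuningPrior.sobolev m)
    (p : unitInterval → ℝ) (hp : Measurable p)
    (pmin pmax : ℝ) (hpmin : 0 < pmin) (hpbd : ∀ x, pmin ≤ p x ∧ p x ≤ pmax)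
    (hp1 : ∫ x : unitInterval, p x = 1)
    (φ : ℕ → unitInterval → ℝ) (ρ : ℕ → ℝ)
    (hφ : TuningPrior.IsEigensystem m A f₀ p φ ρ)
    (σ : ℕ → ℝ) (hσ : ∀ ν < m, 0 < σ ν)
    {Ω : Type*} [MeasurableSpace Ω] (P : Measure Ω) [IsProbabilityMeasure P]
    (w v : ℕ → Ω → ℝ)
    (hw_indep : iIndepFun w P) (hv_indep : iIndepFun v P)
    (hw : ∀ ν, HasLaw (w ν)
      (gaussianReal 0 (Real.toNNReal (TuningPrior.tunedVar m n β lam σ ρ ν))) P)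
    (hv : ∀ ν, HasLaw (v ν)
      (gaussianReal 0 (Real.toNNReal (1 / TuningPrior.tauSq m β σ ρ ν))) P)
    (PiLam Pi0 : Measure (TuningPrior.sobolev m))
    (hPiLam : PiLam = TuningPrior.sobolevLaw P m (TuningPrior.randomSeries φ w))
    (hPi0 : Pi0 = TuningPrior.sobolevLaw P m (TuningPrior.randomSeries φ v)) :
    -- both series converge pointwise and define random elements of the Sobolev space
    (∀ᵐ ω ∂P, (∀ t, Summable fun ν => w ν ω * φ ν t) ∧
      TuningPrior.randomSeries φ w ω ∈ TuningPrior.sobolev m) ∧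
    (∀ᵐ ω ∂P, (∀ t, Summable fun ν => v ν ω * φ ν t) ∧
      TuningPrior.randomSeries φ v ω ∈ TuningPrior.sobolev m) ∧
    IsProbabilityMeasure PiLam ∧ IsProbabilityMeasure Pi0 ∧
    -- the infinite product converges
    Multipliable (fun k : ℕ => √(1 + n * lam * ρ (m + k) ^ (-(β / (2 * m))))) ∧
    -- absolute continuity and the density
    PiLam ≪ Pi0 ∧
    (∀ᵐ f ∂Pi0, PiLam.rnDeriv Pi0 f = ENNReal.ofReal
      ((∏ ν ∈ Finset.range m, √(1 + n * lam * σ ν ^ 2)) *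
        (∏' k : ℕ, √(1 + n * lam * ρ (m + k) ^ (-(β / (2 * m))))) *
        Real.exp (-(n * lam / 2) * TuningPrior.formJ m A f₀ p f f))) ∧
    -- the posterior in terms of the penalized likelihood
    ∀ (x : Fin n → unitInterval) (y : Fin n → ℝ),
      TuningPrior.expMass PiLam (TuningPrior.logLik A x y) Set.univ ≠ 0 ∧
      TuningPrior.expMass PiLam (TuningPrior.logLik A x y) Set.univ ≠ ⊤ ∧
      ∀ B : Set (TuningPrior.sobolev m), NullMeasurableSet B Pi0 →
        TuningPrior.posterior A x y PiLam B =
          TuningPrior.expMass Pi0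
              (fun f => n * TuningPrior.penLik m A f₀ p lam x y f) B /
            TuningPrior.expMass Pi0
              (fun f => n * TuningPrior.penLik m A f₀ p lam x y f) Set.univ := by
  open TuningPrior in
  obtain ⟨c₁, c₂, W⟩ := exists_weightBounds hm hA hA2 hf₀ hp hpmin hpbd
  have E := hφ
  have hκ : 0 ≤ n * lam := mul_nonneg (Nat.cast_nonneg _) hlam
  have hτ : ∀ ν, 0 < 1 / tauSq m β σ ρ ν := fun ν => one_div_pos.2 (E.tauSq_pos hm W hσ ν)
  set t : ℕ → ℝ≥0 := fun ν => Real.toNNReal (1 / tauSq m β σ ρ ν) with ht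
  set s : ℕ → ℝ≥0 := fun ν => Real.toNNReal (tunedVar m n β lam σ ρ ν) with hs
  have htc : ∀ ν, (t ν : ℝ) = 1 / tauSq m β σ ρ ν := fun ν => Real.coe_toNNReal _ (hτ ν).le
  have htpos : ∀ ν, 0 < t ν := fun ν => Real.toNNReal_pos.2 (hτ ν)
  have hden : ∀ ν, 1 ≤ 1 + n * lam * penaltyCoeff m ρ ν * (1 / tauSq m β σ ρ ν) := fun ν => by
    have := mul_nonneg (mul_nonneg hκ (E.penaltyCoeff_nonneg ν)) (hτ ν).le
    linarith
  have hsc : ∀ ν, (s ν : ℝ) = t ν / (1 + n * lam * penaltyCoeff m ρ ν * t ν) := fun ν => by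
    have h1 := E.tunedVar_eq (β := β) (lam := lam) hm W hσ n ν
    rw [htc, ← h1]
    refine Real.coe_toNNReal _ ?_
    rw [h1]
    exact div_nonneg (hτ ν).le (zero_le_one.trans (hden ν))
  have htsum : Summable fun ν => (1 + ρ ν) * (t ν : ℝ) := by
    simp only [htc]
    exact E.summable_one_add_rho_mul hm W hσ hβ
  -- The tuned variances are at most the base ones, so the tuned series inherits its convergence.
  have hssum : Summable fun ν => (1 + ρ ν) * (s ν : ℝ) := by
    refine Summable.of_nonneg_of_le
      (fun ν => mul_nonneg (E.one_add_rho_nonneg ν) (NNReal.coe_nonneg _)) (fun ν => ?_) htsum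
    refine mul_le_mul_of_nonneg_left ?_ (E.one_add_rho_nonneg ν)
    rw [hsc]
    refine div_le_self (NNReal.coe_nonneg _) ?_
    rw [htc]
    exact hden ν
  obtain ⟨hw1, hw2⟩ := E.sobolevLaw_randomSeries hm W hssum hw_indep hw
  obtain ⟨hv1, hv2⟩ := E.sobolevLaw_randomSeries hm W htsum hv_indep hv
  rw [hw2] at hPiLam
  rw [hv2] at hPi0
  have hP1 : IsProbabilityMeasure PiLam := hPiLam ▸ E.isProbabilityMeasure_seriesLaw hm W
  have hP0 : IsProbabilityMeasure Pi0 := hPi0 ▸ E.isProbabilityMeasure_seriesLaw hm W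
  have hx : ∀ k, n * lam * ρ (m + k) ^ (-(β / (2 * m))) =
      n * lam * penaltyCoeff m ρ (m + k) * t (m + k) := fun k => by
    rw [← E.penaltyCoeff_div_tauSq (σ := σ) hm W k, htc]
    ring
  have hmul : Multipliable (fun k : ℕ => √(1 + n * lam * ρ (m + k) ^ (-(β / (2 * m))))) :=
    multipliable_sqrt_one_add
      (fun k => mul_nonneg hκ (Real.rpow_nonneg (E.rho_nonneg _) _))
      ((E.summable_rho_rpow hm W hβ).mul_left _)
  -- The first m factors, where γ_ν/τ_ν² = σ_ν², are split off the infinite product.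
  have hZ : ∏' i, √(1 + n * lam * penaltyCoeff m ρ i * t i) =
      (∏ ν ∈ Finset.range m, √(1 + n * lam * σ ν ^ 2)) *
        ∏' k : ℕ, √(1 + n * lam * ρ (m + k) ^ (-(β / (2 * m)))) := by
    simp only [hx] at hmul ⊢
    rw [← Multipliable.prod_mul_tprod_nat_mul' (k := m)
      (f := fun i => √(1 + n * lam * penaltyCoeff m ρ i * t i))
      (by simpa only [add_comm _ m] using hmul)]
    simp only [add_comm _ m]
    congr 1
    refine Finset.prod_congr rfl fun ν hν => ?_
    rw [htc, penaltyCoeff, tauSq, if_pos (Finset.mem_range.1 hν), if_pos (Finset.mem_range.1 hν)]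
    simp
  obtain ⟨D, hDm, hDeq, hDae⟩ := E.seriesLaw_eq_withDensity hm W htpos hκ hsc htsum
  rw [hZ] at hDae
  rw [← hPiLam, ← hPi0] at hDeq
  rw [← hPi0] at hDae
  set Z := (∏ ν ∈ Finset.range m, √(1 + n * lam * σ ν ^ 2)) *
        ∏' k : ℕ, √(1 + n * lam * ρ (m + k) ^ (-(β / (2 * m)))) with hZdef
  have hZpos : 0 < Z := by
    refine mul_pos (Finset.prod_pos fun ν _ => Real.sqrt_pos.2 ?_) (tprod_sqrt_pos
      (fun k => mul_nonneg hκ (Real.rpow_nonneg (E.rho_nonneg _) _))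
      ((E.summable_rho_rpow hm W hβ).mul_left _))
    have := mul_nonneg hκ (sq_nonneg (σ ν))
    linarith
  refine ⟨hw1, hv1, hP1, hP0, hmul, ?_, ?_, fun x y => ⟨?_, ?_, fun B _ => ?_⟩⟩
  · rw [hDeq]
    exact withDensity_absolutelyContinuous _ _
  · rw [hDeq]
    filter_upwards [Measure.rnDeriv_withDensity Pi0 hDm, hDae] with f h1 h2
    rw [h1, h2]
  · unfold expMass
    rw [Measure.restrict_univ]
    exact lintegral_ofReal_exp_ne_zero (measurable_logLik hA.continuous x y)
  · unfold expMass
    rw [Measure.restrict_univ, hPiLam]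
    exact E.lintegral_exp_logLik_ne_top hm W hssum hA hA2 x y
  · unfold TuningPrior.posterior
    rw [hDeq, expMass_withDensity hn hA.continuous hZpos.le hDm hDae,
      expMass_withDensity hn hA.continuous hZpos.le hDm hDae,
      ENNReal.mul_div_mul_left _ _ (by simpa using hZpos) ENNReal.ofReal_ne_top]
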